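/- Let $\mathbb{K}$ be a field of characteristic zero, let $\Sigma$ be a signature (a set with an arity map $\Sigma\to\mathbb{N}$), and let $T(\Sigma)$ be the free nonsymmetric set operad on $\Sigma$: its elements are the $\Sigma$-terms (planar rooted trees whose internal nodes with $n$ children are decorated by elements of arity $n$), the arity of a term is its number of leaves, the composition $t[t_1,\dots,t_n]$ grafts $t_i$ onto the $i$-th leaf of $t$, and the unit is the leaf. The degree $\deg t$ of a term is its number of internal nodes. Let $\equiv$ be an operad congruence of $T(\Sigma)$ (an arity-preserving equivalence relation compatible with composition) such that $t\equiv t'$ implies $\deg t=\deg t'$ and such that every $\equiv$-class is finite. Let $\mathcal{O}:=T(\Sigma)/{\equiv}$, let $\pi$ be the canonical projection, applied letter by letter to words, and let $\deg$ also denote the induced map on $\mathcal{O}$. For an operad $\mathcal{P}$ with unit $\mathbf{1}$, let $\mathrm{rd}$ be the map deleting the letters $\mathbf{1}$ from words on $\mathcal{P}$. Let $\mathbf{N}(\mathcal{P})$ be the vector space with basis $(E_w)_w$ indexed by the words $w$ on $\mathcal{P}\setminus\{\mathbf{1}\}$, with product $E_wE_{w'}=E_{ww'}$, with counit $E_w\mapsto[w=\epsilon]$,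 and, when every element of $\mathcal{P}$ has finitely many factorizations $x=y[y_1,\dots,y_n]$, with the coproduct $\Delta$ defined as the algebra morphism such that, for $x\neq\mathbf{1}$, $$\Delta(E_x)=\sum_{x=y[y_1,\dots,y_n]}E_{\mathrm{rd}(y)}\otimes E_{\mathrm{rd}(y_1\cdots y_n)}.$$ Given a map $\deg:\mathcal{P}\to\mathbb{N}$, the degree of $E_w$ is the sum of the degrees of the letters of $w$. A $\Sigma$-forest-like alphabet is a set $A$ endowed with a unary relation $R^A$, a unary relation $D_s^A$ for each $s\in\Sigma$, and a binary relation $\to_j^A$ for each $j\ge1$, with no condition. The disjoint sum $A_1+\!\!\!+A_2$ is the set $A_1\sqcup A_2$ with $R:=R^{A_1}\sqcup R^{A_2}$, $D_s:=D_s^{A_1}\sqcup D_s^{A_2}$, and $a\to_j a'$ if and only if $a,a'\in A_1$ and $a\to_j^{A_1}a'$, or $a,a'\in A_2$ and $a\to_j^{A_2}a'$, or $a\in A_1$, $a'\in A_2$ and $a'\in R^{A_2}$. The alphabet of positions $A_p(\Sigma)$ is the set of letters $a^s_u$ with $s\in\Sigma$ and $u\in\mathbb{N}^*$, where $R$ consists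 of the letters $a^s_{0^\ell}$ with $\ell\ge0$, $D_s$ consists of the letters $a^s_u$, and $a^s_u\to_j a^{s'}_{v}$ if and only if $v=u\,j\,0^\ell$ for some $\ell\ge0$. Let $\mathbb{K}\langle A\rangle$ be the graded algebra of noncommutative polynomials on $A$ with possibly infinite support and finite degree. For a word $f$ of terms different from the leaf (a reduced forest), number its internal nodes $1,\dots,\deg f$ in left-to-right preorder. A word $w\in A^*$ is compatible with $f$ if its length is $\deg f$, $w_i\in R^A$ for each root $i$, $w_i\in D^A_s$ for each internal node $i$ decorated by $s$, and $w_i\to_j^A w_{i'}$ whenever the internal node $i'$ is the $j$-th child of the internal node $i$. Let $r_A:\mathbf{N}(T(\Sigma))\to\mathbb{K}\langle A\rangle$ be the linear map sending $E_f$ to the sum of all words compatible with $f$, let $\varphi:\mathbf{N}(\mathcal{O})\to\mathbf{N}(T(\Sigma))$ be the linear map sending $E_x$ to $\sum_{f:\,\pi(f)=x}E_f$, the sum being over reduced forests, and let $\bar r_A:=r_A\circ\varphi$. Let $\theta_{A_1,A_2}$ be the linear map on $\mathbb{K}\langle A_1\sqcup A_2\rangle$, compatible with infinite sums, sending each word $w$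 to $w_{|A_1}\otimes w_{|A_2}$; its values are possibly infinite linear combinations of the tensors $u\otimes v$ with $u\in A_1^*$ and $v\in A_2^*$, a space that contains $\mathbb{K}\langle A_1\rangle\otimes\mathbb{K}\langle A_2\rangle$. Then every element of $\mathcal{O}$ has finitely many factorizations, the map $\deg$ is a grading of $\mathcal{O}$ (it vanishes exactly on the unit, and $\deg(y[y_1,\dots,y_n])=\deg y+\sum_i\deg y_i$), $\mathbf{N}(\mathcal{O})$ is a Hopf algebra, and the class of $\Sigma$-forest-like alphabets, the operation $+\!\!\!+$, the maps $\bar r_A$ and the alphabet $A_p(\Sigma)$ form a polynomial realization of $\mathbf{N}(\mathcal{O})$, that is: 1. $+\!\!\!+$ is associative (up to the canonical bijection) and is the disjoint sum on the underlying sets; 2. for every $\Sigma$-forest-like alphabet $A$, $\bar r_A$ is a graded unital associative algebra morphism; 3. for all $\Sigma$-forest-like alphabets $A_1,A_2$ and all $x\in\mathbf{N}(\mathcal{O})$, $\theta_{A_1,A_2}(\bar r_{A_1+\!\!\!+A_2}(x))=(\bar r_{A_1}\otimes\bar r_{A_2})(\Delta(x))$; 4. $\bar r_{A_p(\Sigma)}$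 is injective. -/

import Mathlib

open scoped TensorProduct

universe u v

noncomputable section

namespace NatHopf

/-! ### Signatures and nonsymmetric operads -/

/-- A signature: a set endowed with an arity map. -/
structure Signature where
  carrier : Type u
  arity : carrier → ℕ

/-- A signature without elements of arity zero. -/
def Signature.Positive (S : Signature.{u}) : Prop := ∀ s, 1 ≤ S.arity s

/-- A nonsymmetric set operad, presented by its full composition maps. The arguments of an
`(m₁ + ⋯ + mₙ)`-ary element are grouped in `n` consecutive blocks by `finSigmaFinEquiv`. -/
structure Operad extends Signature.{u} where
  unit : carrier
  arity_unit : arity unit = 1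
  comp : (x : carrier) → (Fin (arity x) → carrier) → carrier
  arity_comp : ∀ x y, arity (comp x y) = ∑ i, arity (y i)
  unit_comp : ∀ x, comp unit (fun _ => x) = x
  comp_unit : ∀ x, comp x (fun _ => unit) = x
  comp_assoc : ∀ (x : carrier) (y : Fin (arity x) → carrier)
    (z : Fin (arity (comp x y)) → carrier),
    comp (comp x y) z = comp x (fun i => comp (y i)
      (fun j => z (Fin.cast (arity_comp x y).symm (finSigmaFinEquiv ⟨i, j⟩))))

namespace Operad

/-- Every element has finitely many factorizations `x = y[y₁, …, yₙ]`. -/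
def FinitelyFactorizable (O : Operad.{u}) : Prop :=
  ∀ x : O.carrier,
    {p : (y : O.carrier) × (Fin (O.arity y) → O.carrier) | O.comp p.1 p.2 = x}.Finite

/-- `deg` is a grading of the operad `O`. -/
structure IsGrading (O : Operad.{u}) (deg : O.carrier → ℕ) : Prop where
  eq_zero_iff : ∀ x, deg x = 0 ↔ x = O.unit
  comp : ∀ x y, deg (O.comp x y) = deg x + ∑ i, deg (y i)

/-- An operad congruence: an equivalence relation that preserves the arity and is compatible
with the composition. -/
structure Congruence (O : Operad.{u}) where
  setoid : Setoid O.carrier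
  arity_eq : ∀ {x x'}, setoid x x' → O.arity x = O.arity x'
  comp : ∀ {x x'} (y : Fin (O.arity x) → O.carrier) (y' : Fin (O.arity x') → O.carrier),
    setoid x x' → (∀ i i', i.val = i'.val → setoid (y i) (y' i')) →
    setoid (O.comp x y) (O.comp x' y')

namespace Congruence

variable {O : Operad.{u}} (c : O.Congruence)

/-- Underlying set of the quotient operad. -/
def Carrier : Type u := Quotient c.setoid

/-- The canonical projection. -/
def proj (x : O.carrier) : c.Carrier := Quotient.mk c.setoid x

/-- A chosen representative of an equivalence class. -/
def rep (x : c.Carrier) : O.carrier := Quotient.out x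

theorem proj_rep (x : c.Carrier) : c.proj (c.rep x) = x := Quotient.out_eq x

theorem proj_eq_iff {x y : O.carrier} : c.proj x = c.proj y ↔ c.setoid x y := Quotient.eq

/-- Arity of an equivalence class. -/
def quotArity (x : c.Carrier) : ℕ := Quotient.lift O.arity (fun _ _ h => c.arity_eq h) x

theorem arity_rep (x : c.Carrier) : O.arity (c.rep x) = c.quotArity x := by
  conv_rhs => rw [← c.proj_rep x]
  rfl

/-- Composition of equivalence classes; it does not depend on the representatives, see
`quotComp_proj`. -/
def quotComp (x : c.Carrier) (y : Fin (c.quotArity x) → c.Carrier) : c.Carrier :=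
  c.proj (O.comp (c.rep x) (fun i => c.rep (y (Fin.cast (c.arity_rep x) i))))

theorem quotComp_proj (x : O.carrier) (y : Fin (O.arity x) → O.carrier) :
    c.quotComp (c.proj x) (fun i => c.proj (y i)) = c.proj (O.comp x y) := by
  refine c.proj_eq_iff.2 (c.comp _ _ (c.proj_eq_iff.1 (c.proj_rep _)) fun i i' h => ?_)
  rw [← c.proj_eq_iff, c.proj_rep]
  exact congrArg (fun k => c.proj (y k)) (Fin.ext h)

theorem exists_proj (x : c.Carrier) (y : Fin (c.quotArity x) → c.Carrier) :
    ∃ (x' : O.carrier) (y' : Fin (O.arity x') → O.carrier) (h : c.proj x' = x),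
      ∀ i, y i = c.proj (y' (Fin.cast (by rw [← h]; rfl) i)) := by
  refine ⟨c.rep x, fun i => c.rep (y (Fin.cast (c.arity_rep x) i)), c.proj_rep x, fun i => ?_⟩
  rw [c.proj_rep]
  rfl

theorem quotArity_comp (x : c.Carrier) (y : Fin (c.quotArity x) → c.Carrier) :
    c.quotArity (c.quotComp x y) = ∑ i, c.quotArity (y i) := by
  obtain ⟨x, y', rfl, h⟩ := c.exists_proj x y
  obtain rfl : y = fun i => c.proj (y' i) := funext h
  exact (congrArg c.quotArity (c.quotComp_proj x y')).trans (O.arity_comp x y')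

/-- The quotient operad. -/
def quotient : Operad.{u} where
  carrier := c.Carrier
  arity := c.quotArity
  unit := c.proj O.unit
  arity_unit := O.arity_unit
  comp := c.quotComp
  arity_comp := c.quotArity_comp
  unit_comp x := by
    rw [← c.proj_rep x, c.quotComp_proj O.unit (fun _ => c.rep x), O.unit_comp]
  comp_unit x := by
    obtain ⟨x, rfl⟩ : ∃ x', c.proj x' = x := ⟨_, c.proj_rep x⟩
    rw [c.quotComp_proj x (fun _ => O.unit), O.comp_unit]
  comp_assoc x y z := by
    obtain ⟨x, y', rfl, h⟩ := c.exists_proj x y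
    obtain rfl : y = fun i => c.proj (y' i) := funext h
    have key : ∀ (q : c.Carrier) (z : Fin (c.quotArity q) → c.Carrier) (hq : c.proj (O.comp x y') = q),
        c.quotComp q z = c.proj (O.comp (O.comp x y')
          (fun k => c.rep (z (Fin.cast (by rw [← hq]; rfl) k)))) := by
      rintro q z rfl
      exact (congrArg (c.quotComp (c.proj (O.comp x y')))
        (funext fun k => (c.proj_rep (z k)).symm)).trans (c.quotComp_proj _ _)
    refine (key _ z (c.quotComp_proj x y').symm).trans ?_
    refine (congrArg c.proj (O.comp_assoc x y' _)).trans ?_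
    refine (c.quotComp_proj x _).symm.trans (congrArg (c.quotComp (c.proj x)) (funext fun i => ?_))
    refine (c.quotComp_proj (y' i) _).symm.trans
      (congrArg (c.quotComp (c.proj (y' i))) (funext fun j => ?_))
    exact c.proj_rep _

end Congruence

end Operad

/-! ### Terms and free operads -/

/-- Terms on a signature: planar rooted trees whose internal nodes with `n` children are
decorated by elements of arity `n`. -/
inductive STerm (S : Signature.{u}) : Type u
  | leaf : STerm S
  | node (s : S.carrier) (t : Fin (S.arity s) → STerm S) : STerm S

namespace STerm

variable {S : Signature.{u}}

/-- Number of internal nodes. -/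
def degree : STerm S → ℕ
  | leaf => 0
  | node _ t => 1 + ∑ i, (t i).degree

/-- Number of leaves. -/
def arity : STerm S → ℕ
  | leaf => 1
  | node _ t => ∑ i, (t i).arity

/-- `t.graft w` is obtained by grafting the root of `w i` onto the `i`-th leaf of `t`. -/
def graft : (t : STerm S) → (Fin t.arity → STerm S) → STerm S
  | leaf, w => w (0 : Fin 1)
  | node s t, w => node s (fun i => (t i).graft (fun k => w (finSigmaFinEquiv ⟨i, k⟩)))

theorem arity_graft : ∀ (t : STerm S) (w : Fin t.arity → STerm S),
    (t.graft w).arity = ∑ i, (w i).arity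
  | leaf, w => (Fin.sum_univ_one (fun i : Fin 1 => (w i).arity)).symm
  | node s t, w => by
    change ∑ i, ((t i).graft _).arity = ∑ k : Fin (∑ i, (t i).arity), (w k).arity
    rw [← finSigmaFinEquiv.sum_comp, Fintype.sum_sigma]
    exact Finset.sum_congr rfl fun i _ => arity_graft (t i) _

theorem leaf_graft (t : STerm S) : (leaf : STerm S).graft (fun _ => t) = t := rfl

theorem graft_leaf : ∀ t : STerm S, t.graft (fun _ => leaf) = t
  | leaf => rfl
  | node s t => congrArg (node s) (funext fun i => graft_leaf (t i))

theorem sum_range_blocks (N F : ℕ → ℕ) (m : ℕ) :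
    ∑ l ∈ Finset.range (∑ i ∈ Finset.range m, N i), F l =
      ∑ i ∈ Finset.range m, ∑ k ∈ Finset.range (N i), F (∑ i' ∈ Finset.range i, N i' + k) := by
  induction m with
  | zero => simp
  | succ m ih => rw [Finset.sum_range_succ, Finset.sum_range_add, ih, Finset.sum_range_succ]

theorem finSigmaFinEquiv_assoc {m : ℕ} {n : Fin m → ℕ} (a : Fin (∑ i, n i) → ℕ)
    (b : Fin m → ℕ) (hb : ∀ i, b i = ∑ k, a (finSigmaFinEquiv ⟨i, k⟩))
    (i : Fin m) (k : Fin (n i)) (j : Fin (a (finSigmaFinEquiv ⟨i, k⟩))) :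
    (finSigmaFinEquiv (n := b) ⟨i, Fin.cast (hb i).symm
      (finSigmaFinEquiv (n := fun k => a (finSigmaFinEquiv ⟨i, k⟩)) ⟨k, j⟩)⟩ : ℕ) =
      (finSigmaFinEquiv (n := a) ⟨finSigmaFinEquiv ⟨i, k⟩, j⟩ : ℕ) := by
  let N : ℕ → ℕ := fun x => if h : x < m then n ⟨x, h⟩ else 0
  let F : ℕ → ℕ := fun x => if h : x < ∑ i, n i then a ⟨x, h⟩ else 0
  have hN : ∀ x : Fin m, N x = n x := fun x => by simp [N]
  have hF : ∀ x : Fin (∑ i, n i), F x = a x := fun x => by simp [F]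
  have hoff : ∀ (x : Fin m) (y : Fin (n x)),
      (finSigmaFinEquiv (n := n) ⟨x, y⟩ : ℕ) = ∑ i' ∈ Finset.range x, N i' + y := by
    intro x y
    rw [finSigmaFinEquiv_apply, Finset.sum_range]
    congr 1
    exact Finset.sum_congr rfl fun z _ => (hN (Fin.castLE x.2.le z)).symm
  have hb' : ∀ x : Fin m, b x = ∑ y ∈ Finset.range (N x), F (∑ i' ∈ Finset.range x, N i' + y) := by
    intro x
    rw [hb, hN, Finset.sum_range]
    refine Finset.sum_congr rfl fun y _ => ?_
    rw [← hoff, hF]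
  rw [finSigmaFinEquiv_apply, finSigmaFinEquiv_apply]
  simp only [Fin.val_cast]
  rw [finSigmaFinEquiv_apply, ← add_assoc]
  congr 1
  have h1 : ∑ x : Fin (i : ℕ), b (Fin.castLE i.2.le x) =
      ∑ x ∈ Finset.range i, ∑ y ∈ Finset.range (N x), F (∑ i' ∈ Finset.range x, N i' + y) := by
    rw [Finset.sum_range]
    exact Finset.sum_congr rfl fun x _ => hb' (Fin.castLE i.2.le x)
  have h2 : ∑ y : Fin (k : ℕ), a (finSigmaFinEquiv ⟨i, Fin.castLE k.2.le y⟩) =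
      ∑ y ∈ Finset.range k, F (∑ i' ∈ Finset.range i, N i' + y) := by
    rw [Finset.sum_range]
    refine Finset.sum_congr rfl fun y _ => ?_
    rw [← hF, hoff]
    rfl
  have h3 : ∑ l : Fin (finSigmaFinEquiv (n := n) ⟨i, k⟩ : ℕ),
      a (Fin.castLE (finSigmaFinEquiv (n := n) ⟨i, k⟩).2.le l) =
      ∑ l ∈ Finset.range (∑ i' ∈ Finset.range i, N i' + k), F l := by
    rw [← hoff, Finset.sum_range]
    exact Finset.sum_congr rfl fun l _ => (hF _).symm
  exact (congrArg₂ (· + ·) h1 h2).trans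
    ((by rw [Finset.sum_range_add, sum_range_blocks] :
      ∑ l ∈ Finset.range (∑ i' ∈ Finset.range i, N i' + k), F l = _).symm.trans h3.symm)

theorem graft_assoc : ∀ (t : STerm S) (y : Fin t.arity → STerm S)
    (z : Fin (t.graft y).arity → STerm S),
    (t.graft y).graft z = t.graft (fun i => (y i).graft
      (fun j => z (Fin.cast (arity_graft t y).symm (finSigmaFinEquiv ⟨i, j⟩))))
  | leaf, y, z => by
    change (y (0 : Fin 1)).graft z = (y (0 : Fin 1)).graft _
    congr 1
    funext j
    congr 1
    exact Fin.ext (finSigmaFinEquiv_one (n := fun i : Fin 1 => (y i).arity) ⟨0, j⟩).symm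
  | node s t, y, z => by
    refine congrArg (node s) (funext fun i => ?_)
    rw [graft_assoc (t i)]
    congr 1
    funext k
    congr 1
    funext j
    congr 1
    exact Fin.ext (finSigmaFinEquiv_assoc (n := fun i => (t i).arity) (fun l => (y l).arity)
      _ (fun i => arity_graft (t i) _) i k j)

end STerm

/-- The free operad on a signature. -/
def freeOperad (S : Signature.{u}) : Operad.{u} where
  carrier := STerm S
  arity := STerm.arity
  unit := STerm.leaf
  arity_unit := rfl
  comp := STerm.graft
  arity_comp := STerm.arity_graft
  unit_comp := STerm.leaf_graft
  comp_unit := STerm.graft_leaf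
  comp_assoc := STerm.graft_assoc

namespace Operad.Congruence

variable {S : Signature.{u}} (c : (freeOperad S).Congruence)

/-- Congruent terms have the same degree. -/
def DegreeCompatible : Prop := ∀ t t' : STerm S, c.setoid t t' → t.degree = t'.degree

/-- Every equivalence class is finite. -/
def FiniteType : Prop := ∀ t : STerm S, {t' : STerm S | c.setoid t' t}.Finite

/-- The degree of an equivalence class of terms. -/
def quotDegree (h : c.DegreeCompatible) : c.quotient.carrier → ℕ :=
  Quotient.lift STerm.degree h

end Operad.Congruence

/-! ### Natural Hopf algebras -/

/-- The elements of an operad different from the unit. -/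
abbrev Operad.NonUnit (O : Operad.{u}) : Type u := {x : O.carrier // x ≠ O.unit}

/-- Reduced words on an operad: words on its elements different from the unit. -/
abbrev Operad.RWord (O : Operad.{u}) : Type u := FreeMonoid O.NonUnit

open scoped Classical in
/-- The reduced word obtained from `w` by removing its letters equal to the unit. -/
def Operad.rd (O : Operad.{u}) (w : List O.carrier) : O.RWord :=
  FreeMonoid.ofList (w.filterMap fun x => if h : x ≠ O.unit then some ⟨x, h⟩ else none)

/-- A reduced word seen as a word on the operad. -/
def Operad.RWord.word {O : Operad.{u}} (w : O.RWord) : List O.carrier :=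
  (FreeMonoid.toList w).map Subtype.val

section

variable (K : Type v) [Field K] (O : Operad.{u})

/-- The algebra `N(O)`: the linear span of reduced words, with concatenation as product. -/
abbrev NatAlg : Type (max u v) := MonoidAlgebra K O.RWord

variable {O} in
/-- The elementary basis. -/
def elem (w : O.RWord) : NatAlg K O := MonoidAlgebra.single w 1

/-- Linear maps out of `N(O)` defined by their values on the elementary basis. -/
def natLift {M : Type*} [AddCommGroup M] [Module K M] (g : O.RWord → M) : NatAlg K O →ₗ[K] M :=
  Finsupp.linearCombination K g ∘ₗ (MonoidAlgebra.coeffLinearEquiv K).toLinearMap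

/-- The coproduct of `N(O)`: the algebra morphism sending the generator `E_x` to the sum of the
`E_{rd(y)} ⊗ E_{rd(y₁…yₙ)}` over all factorizations `x = y[y₁, …, yₙ]`. The sum is finite as
soon as `O` is finitely factorizable. -/
def comul : NatAlg K O →ₐ[K] NatAlg K O ⊗[K] NatAlg K O :=
  MonoidAlgebra.lift K (NatAlg K O ⊗[K] NatAlg K O) O.RWord (FreeMonoid.lift fun x : O.NonUnit =>
    ∑ᶠ (p : (y : O.carrier) × (Fin (O.arity y) → O.carrier)) (_ : O.comp p.1 p.2 = x.1),
      elem K (O.rd [p.1]) ⊗ₜ[K] elem K (O.rd (List.ofFn p.2)))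

/-- The counit of `N(O)`. -/
def counit : NatAlg K O →ₐ[K] K :=
  MonoidAlgebra.lift K K O.RWord (FreeMonoid.lift fun _ : O.NonUnit => (0 : K))

variable {O} in
/-- The homogeneous component of degree `n` of `N(O)`, for a degree map on `O` extended
additively to words. -/
def natGrading (deg : O.carrier → ℕ) (n : ℕ) : Submodule K (NatAlg K O) :=
  Submodule.span K {x | ∃ w : O.RWord, (w.word.map deg).sum = n ∧ x = elem K w}

end

/-- An algebra `H` together with `Δ` and `ε` is a Hopf algebra. -/
structure IsHopfAlgebra {K : Type*} {H : Type*} [Field K] [Ring H] [Algebra K H]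
    (Δ : H →ₐ[K] H ⊗[K] H) (ε : H →ₐ[K] K) : Prop where
  coassoc : (TensorProduct.assoc K H H H).toLinearMap ∘ₗ Δ.toLinearMap.rTensor H ∘ₗ
    Δ.toLinearMap = Δ.toLinearMap.lTensor H ∘ₗ Δ.toLinearMap
  rTensor_counit : ε.toLinearMap.rTensor H ∘ₗ Δ.toLinearMap = TensorProduct.mk K K H 1
  lTensor_counit : ε.toLinearMap.lTensor H ∘ₗ Δ.toLinearMap = (TensorProduct.mk K H K).flip 1
  antipode : ∃ σ : H →ₗ[K] H,
    LinearMap.mul' K H ∘ₗ σ.rTensor H ∘ₗ Δ.toLinearMap =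
      Algebra.linearMap K H ∘ₗ ε.toLinearMap ∧
    LinearMap.mul' K H ∘ₗ σ.lTensor H ∘ₗ Δ.toLinearMap =
      Algebra.linearMap K H ∘ₗ ε.toLinearMap

/-! ### Noncommutative polynomials with possibly infinite support and finite degree -/

/-- The functions on words that vanish on all words of large enough length. -/
def polySubmodule (K : Type v) [Field K] (A : Type u) : Submodule K (List A → K) where
  carrier := {f | ∃ n, ∀ w : List A, n < w.length → f w = 0}
  zero_mem' := ⟨0, fun _ _ => rfl⟩
  add_mem' := by
    rintro f g ⟨n, hn⟩ ⟨m, hm⟩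
    refine ⟨max n m, fun w hw => ?_⟩
    rw [Pi.add_apply, hn w (by omega), hm w (by omega), add_zero]
  smul_mem' := by
    rintro a f ⟨n, hn⟩
    refine ⟨n, fun w hw => ?_⟩
    rw [Pi.smul_apply, hn w hw, smul_zero]

/-- The space of `A`-polynomials; `f.1 w` is the coefficient of the word `w`. -/
abbrev Poly (K : Type v) [Field K] (A : Type u) : Type (max u v) := polySubmodule K A

namespace Poly

variable {K : Type v} [Field K] {A : Type u}

/-- Convolution of functions on words with respect to concatenation. -/
def conv (f g : List A → K) (w : List A) : K :=
  ∑ i ∈ Finset.range (w.length + 1), f (w.take i) * g (w.drop i)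

theorem conv_nil (f g : List A → K) : conv f g [] = f [] * g [] := by simp [conv]

theorem conv_cons (f g : List A → K) (a : A) (w : List A) :
    conv f g (a :: w) = f [] * g (a :: w) + conv (fun v => f (a :: v)) g w := by
  rw [conv, List.length_cons, Finset.sum_range_succ', add_comm]
  simp [conv]

theorem conv_add_left (f f' g : List A → K) (w : List A) :
    conv (fun v => f v + f' v) g w = conv f g w + conv f' g w := by
  simp [conv, add_mul, Finset.sum_add_distrib]

theorem conv_add_right (f g g' : List A → K) (w : List A) :
    conv f (fun v => g v + g' v) w = conv f g w + conv f g' w := by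
  simp [conv, mul_add, Finset.sum_add_distrib]

theorem conv_smul_left (r : K) (f g : List A → K) (w : List A) :
    conv (fun v => r * f v) g w = r * conv f g w := by
  simp [conv, Finset.mul_sum, mul_assoc]

theorem conv_smul_right (r : K) (f g : List A → K) (w : List A) :
    conv f (fun v => r * g v) w = r * conv f g w := by
  simp [conv, Finset.mul_sum, mul_left_comm]

theorem zero_conv (g : List A → K) (w : List A) : conv (fun _ => 0) g w = 0 := by
  simp [conv]

theorem conv_zero (f : List A → K) (w : List A) : conv f (fun _ => 0) w = 0 := by
  simp [conv]

theorem conv_assoc (f g h : List A → K) (w : List A) :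
    conv (conv f g) h w = conv f (conv g h) w := by
  induction w generalizing f g with
  | nil => simp [conv_nil, mul_assoc]
  | cons a w ih =>
    simp only [conv_cons, conv_nil, conv_add_left, conv_smul_left]
    rw [ih]
    ring

/-- The polynomial `1`, that is, the empty word. -/
def delta : List A → K
  | [] => 1
  | _ :: _ => 0

theorem delta_conv (f : List A → K) (w : List A) : conv delta f w = f w := by
  cases w with
  | nil => simp [conv_nil, delta]
  | cons a w =>
    rw [conv_cons]
    simp only [delta, conv, zero_mul, Finset.sum_const_zero, one_mul, add_zero]

theorem conv_delta (f : List A → K) (w : List A) : conv f delta w = f w := by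
  induction w generalizing f with
  | nil => simp [conv_nil, delta]
  | cons a w ih => simp [conv_cons, delta, ih]

instance : One (Poly K A) :=
  ⟨⟨delta, 0, fun w hw => by cases w with
    | nil => simp at hw
    | cons a w => rfl⟩⟩

instance : Mul (Poly K A) :=
  ⟨fun f g => ⟨conv f.1 g.1, by
    obtain ⟨n, hn⟩ := f.2
    obtain ⟨m, hm⟩ := g.2
    refine ⟨n + m, fun w hw => Finset.sum_eq_zero fun i _ => ?_⟩
    by_cases h : n < (w.take i).length
    · rw [hn _ h, zero_mul]
    · rw [hm _ (by simp only [List.length_take, List.length_drop] at *; omega), mul_zero]⟩⟩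

instance : Ring (Poly K A) :=
  { Submodule.addCommGroup (polySubmodule K A) with
    mul := (· * ·)
    one := 1
    mul_assoc := fun f g h => Subtype.ext (funext (conv_assoc f.1 g.1 h.1))
    one_mul := fun f => Subtype.ext (funext (delta_conv f.1))
    mul_one := fun f => Subtype.ext (funext (conv_delta f.1))
    left_distrib := fun f g h => Subtype.ext (funext (conv_add_right f.1 g.1 h.1))
    right_distrib := fun f g h => Subtype.ext (funext (conv_add_left f.1 g.1 h.1))
    zero_mul := fun f => Subtype.ext (funext (zero_conv f.1))
    mul_zero := fun f => Subtype.ext (funext (conv_zero f.1)) }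

instance : Algebra K (Poly K A) :=
  Algebra.ofModule
    (fun r f g => Subtype.ext (funext (conv_smul_left r f.1 g.1)))
    (fun r f g => Subtype.ext (funext (conv_smul_right r f.1 g.1)))

end Poly

section

variable (K : Type v) [Field K]

/-- The homogeneous polynomials of degree `n`. -/
def polyGrading (A : Type u) (n : ℕ) : Submodule K (Poly K A) where
  carrier := {f | ∀ w : List A, w.length ≠ n → f.1 w = 0}
  zero_mem' := fun _ _ => rfl
  add_mem' := by
    intro f g hf hg w hw
    change f.1 w + g.1 w = 0
    rw [hf w hw, hg w hw, add_zero]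
  smul_mem' := by
    intro r f hf w hw
    change r * f.1 w = 0
    rw [hf w hw, mul_zero]

/-- The canonical map sending `f ⊗ g` to the series `∑ f(u) g(v) u ⊗ v` in two sets of
variables. It is injective, see `toPairs_injective`. -/
def toPairs (A B : Type u) : Poly K A ⊗[K] Poly K B →ₗ[K] (List A × List B → K) :=
  TensorProduct.lift (LinearMap.mk₂ K (fun f g p => f.1 p.1 * g.1 p.2)
    (fun f f' g => funext fun p => add_mul (f.1 p.1) (f'.1 p.1) (g.1 p.2))
    (fun r f g => funext fun p => mul_assoc r (f.1 p.1) (g.1 p.2))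
    (fun f g g' => funext fun p => mul_add (f.1 p.1) (g.1 p.2) (g'.1 p.2))
    (fun r f g => funext fun p => mul_left_comm (f.1 p.1) r (g.1 p.2)))

theorem toPairs_injective (A B : Type u) : Function.Injective (toPairs K A B) := by
  classical
  rw [injective_iff_map_eq_zero]
  intro x hx
  let b := Module.Basis.ofVectorSpace K (Poly K A)
  obtain ⟨g, rfl⟩ := (TensorProduct.equivFinsuppOfBasisLeft (N := Poly K B) b).symm.surjective x
  rw [TensorProduct.equivFinsuppOfBasisLeft_symm_apply] at hx ⊢
  have hg : ∀ v : List B, Finsupp.linearCombination K b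
      (g.mapRange (fun p : Poly K B => p.1 v) rfl) = 0 := by
    intro v
    refine Subtype.ext (funext fun w => ?_)
    have h := congrFun hx (w, v)
    rw [Finsupp.sum, map_sum] at h
    rw [Finsupp.linearCombination_apply, Finsupp.sum_mapRange_index (by simp), Finsupp.sum]
    simp only [AddSubmonoidClass.coe_finsetSum, Finset.sum_apply] at h ⊢
    refine Eq.trans (Finset.sum_congr rfl fun i _ => ?_) h
    exact mul_comm ((g i).1 v) ((b i).1 w)
  have : g = 0 := by
    ext i v
    exact DFunLike.congr_fun
      ((linearIndependent_iff.1 b.linearIndependent) _ (hg v)) i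
  rw [this, Finsupp.sum_zero_index]

/-- The subword of `w` made of its letters in the first summand. -/
def leftPart {A B : Type u} (w : List (A ⊕ B)) : List A := w.filterMap Sum.getLeft?

/-- The subword of `w` made of its letters in the second summand. -/
def rightPart {A B : Type u} (w : List (A ⊕ B)) : List B := w.filterMap Sum.getRight?

/-- The words on `A ⊕ B` whose subwords on `A` and on `B` are `u` and `v`. -/
def shuffles {A B : Type u} (u : List A) (v : List B) : Set (List (A ⊕ B)) :=
  {w | leftPart w = u ∧ rightPart w = v}

theorem shuffles_finite {A B : Type u} (u : List A) (v : List B) : (shuffles u v).Finite := by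
  have key : ∀ (n : ℕ) (u : List A) (v : List B), u.length + v.length = n →
      (shuffles u v).Finite := by
    intro n
    induction n with
    | zero =>
      intro u v h
      refine (Set.finite_singleton []).subset ?_
      rintro (_ | ⟨a | b, w⟩) ⟨rfl, rfl⟩
      · rfl
      · simp [leftPart] at h
      · simp [rightPart] at h
    | succ n ih =>
      intro u v h
      have h1 : {w | ∃ a w', w = Sum.inl a :: w' ∧ w ∈ shuffles u v}.Finite := by
        cases u with
        | nil =>
          refine Set.finite_empty.subset ?_
          rintro _ ⟨a, w', rfl, hw, -⟩
          simp [leftPart] at hw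
        | cons a u =>
          refine ((ih u v (by simp at h; omega)).image (Sum.inl a :: ·)).subset ?_
          rintro _ ⟨a', w', rfl, hw, hw'⟩
          simp only [leftPart, rightPart, List.filterMap_cons, Sum.getLeft?_inl,
            Sum.getRight?_inl, List.cons.injEq] at hw hw'
          exact ⟨w', ⟨hw.2, hw'⟩, by rw [hw.1]⟩
      have h2 : {w | ∃ b w', w = Sum.inr b :: w' ∧ w ∈ shuffles u v}.Finite := by
        cases v with
        | nil =>
          refine Set.finite_empty.subset ?_
          rintro _ ⟨a, w', rfl, -, hw⟩
          simp [rightPart] at hw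
        | cons b v =>
          refine ((ih u v (by simp at h; omega)).image (Sum.inr b :: ·)).subset ?_
          rintro _ ⟨a', w', rfl, hw', hw⟩
          simp only [leftPart, rightPart, List.filterMap_cons, Sum.getLeft?_inr,
            Sum.getRight?_inr, List.cons.injEq] at hw hw'
          exact ⟨w', ⟨hw', hw.2⟩, by rw [hw.1]⟩
      refine ((h1.union h2).union (Set.finite_singleton [])).subset ?_
      rintro (_ | ⟨a | b, w⟩) hw
      · exact Or.inr rfl
      · exact Or.inl (Or.inl ⟨a, w, rfl, hw⟩)
      · exact Or.inl (Or.inr ⟨b, w, rfl, hw⟩)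
  exact key _ u v rfl

/-- The map `θ`, linear also with respect to infinite sums, sending a word `w` on `A ⊕ B` to
`w_{|A} ⊗ w_{|B}`. As polynomials may have an infinite support, its values are series in two
sets of variables; they need not lie in the image of the algebraic tensor product. -/
def theta (A B : Type u) : Poly K (A ⊕ B) →ₗ[K] (List A × List B → K) where
  toFun f p := ∑ᶠ w ∈ shuffles p.1 p.2, f.1 w
  map_add' _ _ := funext fun p => finsum_mem_add_distrib (shuffles_finite p.1 p.2)
  map_smul' r _ := funext fun p =>
    (smul_finsum_mem (r := r) (shuffles_finite p.1 p.2)).symm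

end

/-! ### Related alphabets and polynomial realizations -/

/-- A set endowed with an `n`-ary relation for each `n`-ary element of the signature `R`. -/
structure RelatedAlphabet (R : Signature.{u}) where
  carrier : Type u
  rel : (r : R.carrier) → (Fin (R.arity r) → carrier) → Prop

/-- An operation on related alphabets which is the disjoint sum on the underlying sets: a
choice of relations on the disjoint sum of the underlying sets of any two alphabets. -/
abbrev SumRel (R : Signature.{u}) : Type (u + 1) :=
  (A B : RelatedAlphabet R) → (r : R.carrier) →
    (Fin (R.arity r) → A.carrier ⊕ B.carrier) → Prop

/-- The value of the operation on two related alphabets. -/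
abbrev SumRel.sum {R : Signature.{u}} (op : SumRel R) (A B : RelatedAlphabet R) :
    RelatedAlphabet R :=
  ⟨A.carrier ⊕ B.carrier, op A B⟩

/-- The class `𝒜` of related alphabets, the operation `op`, the maps `ρ A` for `A` in `𝒜`, and
the alphabet `𝔸` form a polynomial realization of the graded Hopf algebra `H` with homogeneous
components `gr n` and coproduct `Δ`. -/
structure IsPolynomialRealization {K : Type v} [Field K] {H : Type*} [Ring H] [Algebra K H]
    (gr : ℕ → Submodule K H) (Δ : H →ₐ[K] H ⊗[K] H) {R : Signature.{u}}
    (𝒜 : Set (RelatedAlphabet R)) (op : SumRel R)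
    (ρ : (A : RelatedAlphabet R) → H →ₗ[K] Poly K A.carrier) (𝔸 : RelatedAlphabet R) :
    Prop where
  /-- Related alphabet signatures are positive. -/
  positive : R.Positive
  sum_mem : ∀ A ∈ 𝒜, ∀ B ∈ 𝒜, op.sum A B ∈ 𝒜
  /-- The canonical bijection between the two iterated disjoint sums is an isomorphism. -/
  sum_assoc : ∀ A ∈ 𝒜, ∀ B ∈ 𝒜, ∀ C ∈ 𝒜, ∀ r x,
    (op.sum (op.sum A B) C).rel r x ↔
      (op.sum A (op.sum B C)).rel r (fun i => Equiv.sumAssoc _ _ _ (x i))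
  map_one : ∀ A ∈ 𝒜, ρ A 1 = 1
  map_mul : ∀ A ∈ 𝒜, ∀ x y, ρ A (x * y) = ρ A x * ρ A y
  graded : ∀ A ∈ 𝒜, ∀ n, ∀ x ∈ gr n, ρ A x ∈ polyGrading K A.carrier n
  /-- The alphabet doubling trick. -/
  doubling : ∀ A ∈ 𝒜, ∀ B ∈ 𝒜, ∀ x,
    theta K A.carrier B.carrier (ρ (op.sum A B) x) =
      toPairs K A.carrier B.carrier (TensorProduct.map (ρ A) (ρ B) (Δ x))
  mem : 𝔸 ∈ 𝒜
  injective : Function.Injective (ρ 𝔸)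

/-! ### Forest-like alphabets -/

/-- The symbols of the signature of forest-like alphabets. -/
inductive ForestSymbol (T : Type u) : Type u
  | root : ForestSymbol T
  | dec (s : T) : ForestSymbol T
  | edge (j : ℕ+) : ForestSymbol T

/-- The related alphabet signature of forest-like alphabets. -/
abbrev forestSignature (T : Type u) : Signature.{u} where
  carrier := ForestSymbol T
  arity
    | .root => 1
    | .dec _ => 1
    | .edge _ => 2

/-- Forest-like alphabets; there is no condition on the relations. -/
abbrev ForestAlphabet (T : Type u) : Type (u + 1) := RelatedAlphabet (forestSignature T)

namespace ForestAlphabet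

variable {T : Type u} (A : ForestAlphabet T)

/-- The root relation. -/
def IsRoot (a : A.carrier) : Prop := A.rel .root ![a]

/-- The decoration relations. -/
def IsDec (s : T) (a : A.carrier) : Prop := A.rel (.dec s) ![a]

/-- The edge relations. -/
def IsEdge (j : ℕ+) (a a' : A.carrier) : Prop := A.rel (.edge j) ![a, a']

/-- The relations of the disjoint sum of two forest-like alphabets. -/
def sumRel (T : Type u) : SumRel (forestSignature T) := fun A B r =>
  match r with
  | .root => fun x => Sum.elim (IsRoot A) (IsRoot B) (x 0)
  | .dec s => fun x => Sum.elim (IsDec A s) (IsDec B s) (x 0)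
  | .edge j => fun x =>
    match x 0, x 1 with
    | .inl a, .inl a' => IsEdge A j a a'
    | .inr b, .inr b' => IsEdge B j b b'
    | .inl _, .inr b' => IsRoot B b'
    | .inr _, .inl _ => False

/-- The forest-like alphabet of positions; the letter `a^s_u` is the pair `(s, u)`. -/
def positions (T : Type u) : ForestAlphabet T where
  carrier := T × List ℕ
  rel
    | .root => fun x => ∃ l, (x 0).2 = List.replicate l 0
    | .dec s => fun x => (x 0).1 = s
    | .edge j => fun x => ∃ l, (x 1).2 = (x 0).2 ++ [(j : ℕ)] ++ List.replicate l 0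

end ForestAlphabet

/-! ### Internal nodes of forests

Internal nodes are identified with their positions in the left to right preorder traversal,
counted from `0`. -/

namespace STerm

variable {S : Signature.{u}}

/-- The decorations of the internal nodes, in preorder. -/
def decorations : STerm S → List S.carrier
  | leaf => []
  | node s t => s :: (List.ofFn fun i => (t i).decorations).flatten

/-- In `node s t`, the nodes of the subterm `t k` are numbered from this number on. -/
def offset {n : ℕ} (t : Fin n → STerm S) (k : Fin n) : ℕ :=
  1 + ∑ k' ∈ Finset.Iio k, (t k').degree

/-- `t.Edge j i i'`: the internal node `i'` is the `j`-th child of the internal node `i`. -/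
inductive Edge : STerm S → ℕ+ → ℕ → ℕ → Prop
  | root (s : S.carrier) (t : Fin (S.arity s) → STerm S) (k : Fin (S.arity s)) (h : t k ≠ leaf) :
      Edge (node s t) k.val.succPNat 0 (offset t k)
  | child (s : S.carrier) (t : Fin (S.arity s) → STerm S) (k : Fin (S.arity s)) (j : ℕ+)
      (i i' : ℕ) (h : Edge (t k) j i i') :
      Edge (node s t) j (offset t k + i) (offset t k + i')

end STerm

/-- Forests are words of terms. -/
abbrev Forest (S : Signature.{u}) : Type u := List (STerm S)

namespace Forest

variable {S : Signature.{u}} (f : Forest S)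

/-- Number of internal nodes. -/
def degree : ℕ := (f.map STerm.degree).sum

/-- The decorations of the internal nodes, in preorder. -/
def decorations : List S.carrier := f.flatMap STerm.decorations

/-- The internal node `i` is the root of a term of the forest. -/
def IsRoot (i : ℕ) : Prop :=
  ∃ (f₁ : Forest S) (t : STerm S) (f₂ : Forest S),
    f = f₁ ++ t :: f₂ ∧ t ≠ STerm.leaf ∧ i = degree f₁

/-- The internal node `i'` is the `j`-th child of the internal node `i`. -/
def Edge (j : ℕ+) (i i' : ℕ) : Prop :=
  ∃ (f₁ : Forest S) (t : STerm S) (f₂ : Forest S) (k k' : ℕ),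
    f = f₁ ++ t :: f₂ ∧ t.Edge j k k' ∧ i = degree f₁ + k ∧ i' = degree f₁ + k'

/-- The word `w` on the alphabet `A` is compatible with the forest `f`. -/
structure Compatible (A : ForestAlphabet S.carrier) (w : List A.carrier) : Prop where
  length : w.length = degree f
  root : ∀ (i : ℕ) a, IsRoot f i → w[i]? = some a → ForestAlphabet.IsRoot A a
  dec : ∀ (i : ℕ) a s, (decorations f)[i]? = some s → w[i]? = some a → ForestAlphabet.IsDec A s a
  edge : ∀ j (i i' : ℕ) a a', Edge f j i i' → w[i]? = some a → w[i']? = some a' →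
    ForestAlphabet.IsEdge A j a a'

end Forest

section

variable (K : Type v) [Field K] {S : Signature.{u}}

open scoped Classical in
/-- The sum of all the words that are compatible with a forest. -/
def compatibleSum (A : ForestAlphabet S.carrier) (f : Forest S) : Poly K A.carrier :=
  ⟨fun w => if Forest.Compatible f A w then 1 else 0,
    Forest.degree f, fun _ hw => if_neg fun h => hw.ne' h.length⟩

/-- The realizing map `r_A` on `N(T(S))`. -/
def realize (A : ForestAlphabet S.carrier) : NatAlg K (freeOperad S) →ₗ[K] Poly K A.carrier :=
  natLift K (freeOperad S) fun f => compatibleSum K A f.word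

/-- The map `φ` from the natural Hopf algebra of a quotient of the free operad to that of the
free operad, sending `E_x` to the sum of the `E_f` over all the reduced forests `f` that project
onto `x`. The sum is finite as soon as the congruence is of finite type. -/
def quotientMap (c : (freeOperad S).Congruence) :
    NatAlg K c.quotient →ₗ[K] NatAlg K (freeOperad S) :=
  natLift K c.quotient fun x =>
    ∑ᶠ (f : (freeOperad S).RWord) (_ : f.word.map c.proj = x.word), elem K f

/-- The map `r̄_A = r_A ∘ φ`. -/
def quotientRealize (c : (freeOperad S).Congruence) (A : ForestAlphabet S.carrier) :
    NatAlg K c.quotient →ₗ[K] Poly K A.carrier :=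
  realize K A ∘ₗ quotientMap K c

end

end NatHopf

end

open NatHopf

/-!
A grading vanishing only on the unit makes `N(O)` connected, so the antipode exists by a geometric
series for convolution, and coassociativity comes from regrouping the factorizations
`x = y[y₁[…], …, yₙ[…]]`. Since each class of the congruence is finite and lies in a single degree,
summing over fibers is a bialgebra morphism `φ : N(O) → N(T(Σ))`, which is injective because fibers
of distinct words are disjoint. It remains to realize `N(T(Σ))`. The words compatible with a term
form a language built recursively from the languages of its subterms, and those compatible with a
forest form the concatenation of the languages of its terms; this gives multiplicativity. A word on
`A₁ ++ A₂` compatible with a term splits it along a cut, the letters of `A₁` labelling the part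
above and the letters of `A₂` the forest below, because edges may go from `A₁` to roots of `A₂` but
never back; such cuts are the factorizations of the term. Finally, the letters of `A_p(Σ)` record
the position of a node, so labelling each node by its own position gives a compatible word
from which the forest can be recovered.
-/

noncomputable section

namespace NatHopf

section Lists

theorem ofFn_eq_flatten {α : Type*} {m : ℕ} {n : Fin m → ℕ} (g : Fin (∑ i, n i) → α) :
    List.ofFn g = (List.ofFn fun i => List.ofFn fun j => g (finSigmaFinEquiv ⟨i, j⟩)).flatten := by
  induction m with
  | zero => simp
  | succ m ih =>
    rw [List.ofFn_congr (Fin.sum_univ_castSucc n), List.ofFn_add, ih, List.ofFn_succ',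
      List.concat_eq_append, List.flatten_append, List.flatten_singleton]
    congr! 7
    all_goals
      ext
      simp only [finSigmaFinEquiv_apply, Fin.val_cast, Fin.val_castLE, Fin.val_natAdd]
      rfl

theorem prod_ofFn_sum {R : Type*} [Semiring R] {n : ℕ} {ι : Fin n → Type*}
    (s : ∀ i, Finset (ι i)) (f : ∀ i, ι i → R) :
    (List.ofFn fun i => ∑ a ∈ s i, f i a).prod =
      ∑ q ∈ Fintype.piFinset s, (List.ofFn fun i => f i (q i)).prod := by
  induction n with
  | zero => simp
  | succ n ih =>
    rw [List.ofFn_succ, List.prod_cons, ih, Finset.sum_mul_sum, ← Finset.sum_product']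
    refine Finset.sum_equiv (Fin.consEquiv ι) (fun p => ?_) fun p _ => ?_
    · simp [Fin.forall_fin_succ]
    · simp [List.ofFn_succ]

theorem prod_ofFn_tmul {K R R' : Type*} [CommSemiring K] [Semiring R] [Semiring R'] [Algebra K R]
    [Algebra K R'] {n : ℕ} (f : Fin n → R) (g : Fin n → R') :
    (List.ofFn fun i => f i ⊗ₜ[K] g i).prod = (List.ofFn f).prod ⊗ₜ (List.ofFn g).prod := by
  induction n with
  | zero => simp [Algebra.TensorProduct.one_def]
  | succ n ih => simp [List.ofFn_succ, ih]

theorem map_prod_ofFn {F R R' : Type*} [Monoid R] [Monoid R'] [FunLike F R R']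
    [MonoidHomClass F R R'] (f : F) {n : ℕ} (g : Fin n → R) :
    f (List.ofFn g).prod = (List.ofFn fun i => f (g i)).prod := by
  rw [map_list_prod, List.map_ofFn]
  rfl

end Lists

namespace Operad

variable {O : Operad.{u}}

/-- A formal composite `y[y₁, …, yₙ]`: an element together with a sequence of arguments. -/
abbrev Composite (O : Operad.{u}) : Type u := (y : O.carrier) × (Fin (O.arity y) → O.carrier)

/-- The factorizations `x = y[y₁, …, yₙ]` of an element of a finitely factorizable operad. -/
def factorizations (hO : O.FinitelyFactorizable) (x : O.carrier) : Finset O.Composite :=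
  (hO x).toFinset

@[simp]
theorem mem_factorizations {hO : O.FinitelyFactorizable} {x : O.carrier} {p : O.Composite} :
    p ∈ factorizations hO x ↔ O.comp p.1 p.2 = x :=
  Set.Finite.mem_toFinset _

/-- The arguments of `x[y₁, …, yₙ]` obtained by juxtaposing arguments of `y₁`, …, `yₙ`. -/
def joinArgs (x : O.carrier) (y : Fin (O.arity x) → O.carrier) :
    (∀ i, Fin (O.arity (y i)) → O.carrier) ≃ (Fin (O.arity (O.comp x y)) → O.carrier) :=
  (Equiv.piCurry _).symm.trans
    ((finSigmaFinEquiv.trans (finCongr (O.arity_comp x y).symm)).arrowCongr (Equiv.refl _))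

section

variable (x : O.carrier) (y : Fin (O.arity x) → O.carrier)
  (z : ∀ i, Fin (O.arity (y i)) → O.carrier)

theorem joinArgs_apply (i : Fin (O.arity x)) (j : Fin (O.arity (y i))) :
    joinArgs x y z (Fin.cast (O.arity_comp x y).symm (finSigmaFinEquiv ⟨i, j⟩)) = z i j := by
  change Sigma.uncurry z (finSigmaFinEquiv.symm (finSigmaFinEquiv ⟨i, j⟩)) = z i j
  rw [Equiv.symm_apply_apply]
  rfl

theorem comp_joinArgs :
    O.comp (O.comp x y) (joinArgs x y z) = O.comp x fun i => O.comp (y i) (z i) := by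
  rw [O.comp_assoc]
  simp only [joinArgs_apply]

theorem ofFn_joinArgs :
    List.ofFn (joinArgs x y z) = (List.ofFn fun i => List.ofFn (z i)).flatten := by
  rw [List.ofFn_congr (O.arity_comp x y), ofFn_eq_flatten]
  simp only [joinArgs_apply]

end

theorem IsGrading.comp_eq_unit_iff {deg : O.carrier → ℕ} (h : O.IsGrading deg) (p : O.Composite) :
    O.comp p.1 p.2 = O.unit ↔ p = ⟨O.unit, fun _ => O.unit⟩ := by
  refine ⟨fun hp => ?_, by rintro rfl; exact O.comp_unit _⟩
  obtain ⟨y, z⟩ := p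
  have hdeg : deg y + ∑ i, deg (z i) = 0 := by rw [← h.comp, h.eq_zero_iff, hp]
  rw [Nat.add_eq_zero_iff, Finset.sum_eq_zero_iff, h.eq_zero_iff] at hdeg
  obtain ⟨rfl, hz⟩ := hdeg
  rw [show z = fun _ => O.unit from funext fun i => (h.eq_zero_iff _).1 (hz i (Finset.mem_univ i))]

theorem rd_unit : O.rd [O.unit] = 1 := by
  simp [rd]

theorem rd_singleton (x : O.NonUnit) : O.rd [x.1] = FreeMonoid.of x := by
  simp [rd, x.2]

theorem rd_cons (x : O.carrier) (l : List O.carrier) : O.rd (x :: l) = O.rd [x] * O.rd l := by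
  by_cases h : x = O.unit <;> simp [rd, h]

theorem word_of_mul (x : O.NonUnit) (w : O.RWord) :
    RWord.word (FreeMonoid.of x * w) = x.1 :: w.word :=
  rfl

theorem rd_word (w : O.RWord) : O.rd w.word = w := by
  induction w using FreeMonoid.inductionOn' with
  | one => rfl
  | of_mul x w ih => rw [word_of_mul, rd_cons, rd_singleton, ih]

theorem word_injective : Function.Injective (RWord.word : O.RWord → List O.carrier) :=
  Function.LeftInverse.injective rd_word

theorem unit_notMem_word (w : O.RWord) : O.unit ∉ w.word := by
  rw [RWord.word, List.mem_map]
  rintro ⟨x, -, hx⟩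
  exact x.2 hx

theorem word_rd {l : List O.carrier} (hl : O.unit ∉ l) : (O.rd l).word = l := by
  induction l with
  | nil => rfl
  | cons x l ih =>
    rw [List.mem_cons, not_or] at hl
    rw [rd_cons, rd_singleton ⟨x, Ne.symm hl.1⟩, word_of_mul, ih hl.2]

end Operad

section NatAlg

variable (K : Type v) [Field K] {O : Operad.{u}}

theorem elem_one : elem K (1 : O.RWord) = 1 := rfl

theorem elem_mul (w w' : O.RWord) : elem K (w * w') = elem K w * elem K w' := by
  simp only [elem, MonoidAlgebra.single_mul_single, one_mul]

variable {K} in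
theorem natLift_elem {M : Type*} [AddCommGroup M] [Module K M] (g : O.RWord → M) (w : O.RWord) :
    natLift K O g (elem K w) = g w := by
  simp [natLift, elem, MonoidAlgebra.coeffLinearEquiv]

theorem natAlg_linearMap_ext {K : Type v} [Field K] {M : Type*} [AddCommGroup M] [Module K M]
    {f g : NatAlg K O →ₗ[K] M} (h : ∀ w, f (elem K w) = g (elem K w)) : f = g :=
  MonoidAlgebra.lhom_ext' fun w => LinearMap.ext_ring (h w)

variable {K} in
theorem natAlg_injective_of_dual {M : Type*} [AddCommGroup M] [Module K M]
    {F : NatAlg K O →ₗ[K] M} (ℓ : O.RWord → M →ₗ[K] K)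
    (hone : ∀ w, ℓ w (F (elem K w)) = 1) (hzero : ∀ w w', w' ≠ w → ℓ w (F (elem K w')) = 0) :
    Function.Injective F := by
  classical
  have hcoeff (w : O.RWord) : ℓ w ∘ₗ F =
      Finsupp.lapply w ∘ₗ (MonoidAlgebra.coeffLinearEquiv K).toLinearMap := by
    refine natAlg_linearMap_ext fun w' => Eq.trans ?_ (Finsupp.single_apply (a := w')).symm
    split_ifs with h
    · exact h ▸ hone w'
    · exact hzero w w' h
  intro x y h
  refine MonoidAlgebra.coeff_injective (Finsupp.ext fun w => ?_)
  calc
    x.coeff w = ℓ w (F x) := (LinearMap.congr_fun (hcoeff w) x).symm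
    _ = ℓ w (F y) := congrArg (ℓ w) h
    _ = y.coeff w := LinearMap.congr_fun (hcoeff w) y

/-- The element `E_{rd(x)}` of `N(O)`: the generator `E_x`, or `1` when `x` is the unit. -/
def letter (x : O.carrier) : NatAlg K O := elem K (O.rd [x])

theorem letter_unit : letter K O.unit = 1 := by
  rw [letter, Operad.rd_unit, elem_one]

theorem letter_nonUnit (x : O.NonUnit) : letter K x.1 = elem K (FreeMonoid.of x) := by
  rw [letter, Operad.rd_singleton]

theorem elem_rd (l : List O.carrier) : elem K (O.rd l) = (l.map (letter K)).prod := by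
  induction l with
  | nil => rfl
  | cons x l ih => rw [Operad.rd_cons, elem_mul, ih, List.map_cons, List.prod_cons, letter]

theorem elem_rd_ofFn {n : ℕ} (y : Fin n → O.carrier) :
    elem K (O.rd (List.ofFn y)) = (List.ofFn fun i => letter K (y i)).prod := by
  rw [elem_rd, List.map_ofFn]
  rfl

theorem elem_eq_prod (w : O.RWord) : elem K w = (w.word.map (letter K)).prod := by
  rw [← elem_rd, Operad.rd_word]

variable {K} in
theorem natAlg_algHom_ext {B : Type*} [Semiring B] [Algebra K B] {f g : NatAlg K O →ₐ[K] B}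
    (h : ∀ x : O.NonUnit, f (letter K x.1) = g (letter K x.1)) : f = g := by
  refine MonoidAlgebra.algHom_ext' (FreeMonoid.hom_eq fun x => ?_) (by ext)
  have hx := h x
  rw [letter_nonUnit] at hx
  exact hx

/-- The algebra morphism out of `N(O)` sending the generator `E_x` to `g x`. -/
def algLift {B : Type*} [Semiring B] [Algebra K B] (g : O.carrier → B) : NatAlg K O →ₐ[K] B :=
  MonoidAlgebra.lift K B O.RWord (FreeMonoid.lift fun x : O.NonUnit => g x.1)

variable {K} in
theorem algLift_letter {B : Type*} [Semiring B] [Algebra K B] {g : O.carrier → B}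
    (hg : g O.unit = 1) (x : O.carrier) : algLift K g (letter K x) = g x := by
  by_cases hx : x = O.unit
  · rw [hx, letter_unit, map_one, hg]
  · rw [letter_nonUnit K ⟨x, hx⟩, algLift, elem, MonoidAlgebra.lift_single, one_smul,
      FreeMonoid.lift_eval_of]

open Operad in
theorem comul_letter (hO : O.FinitelyFactorizable) {deg : O.carrier → ℕ} (h : O.IsGrading deg)
    (x : O.carrier) :
    comul K O (letter K x) = ∑ p ∈ factorizations hO x,
      letter K p.1 ⊗ₜ[K] (List.ofFn fun i => letter K (p.2 i)).prod := by
  by_cases hx : x = O.unit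
  · have hunit : factorizations hO O.unit = {⟨O.unit, fun _ => O.unit⟩} := by
      ext p
      rw [mem_factorizations, h.comp_eq_unit_iff, Finset.mem_singleton]
    simp [hx, hunit, letter_unit, Algebra.TensorProduct.one_def]
  · rw [letter_nonUnit K ⟨x, hx⟩, comul, elem, MonoidAlgebra.lift_single, one_smul,
      FreeMonoid.lift_eval_of]
    refine (finsum_mem_eq_finite_toFinset_sum _ (hO x)).trans (Finset.sum_congr rfl fun p _ => ?_)
    rw [elem_rd_ofFn, letter]

open scoped Classical in
theorem counit_letter (x : O.carrier) :
    counit K O (letter K x) = if x = O.unit then 1 else 0 := by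
  split_ifs with hx
  · rw [hx, letter_unit, map_one]
  · rw [letter_nonUnit K ⟨x, hx⟩, counit, elem, MonoidAlgebra.lift_single, one_smul,
      FreeMonoid.lift_eval_of]

end NatAlg

section Coalgebra

open Operad

variable (K : Type v) [Field K] {O : Operad.{u}}

/-- The two ways of summing over the iterated factorizations `x = z[y₁[w₁], …, yₙ[wₙ]]`,
grouped as `(z[y₁, …, yₙ])[w₁ ⋯ wₙ]` or by the elements `yᵢ[wᵢ]`. -/
theorem sum_factorizations_assoc (hO : O.FinitelyFactorizable) {M : Type*} [AddCommMonoid M]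
    (F : O.Composite → O.Composite → M) (x : O.carrier) :
    ∑ p ∈ factorizations hO x, ∑ q ∈ factorizations hO p.1, F p q =
      ∑ p ∈ factorizations hO x, ∑ q ∈ Fintype.piFinset fun i => factorizations hO (p.2 i),
        F ⟨O.comp p.1 fun i => (q i).1, joinArgs p.1 (fun i => (q i).1) fun i => (q i).2⟩
          ⟨p.1, fun i => (q i).1⟩ := by
  rw [Finset.sum_sigma', Finset.sum_sigma']
  symm
  refine Finset.sum_bij (fun a _ =>
    ⟨⟨O.comp a.1.1 fun i => (a.2 i).1, joinArgs a.1.1 (fun i => (a.2 i).1) fun i => (a.2 i).2⟩,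
      ⟨a.1.1, fun i => (a.2 i).1⟩⟩) ?_ ?_ ?_ fun _ _ => rfl
  · rintro ⟨⟨z, v⟩, q⟩ h
    simp only [Finset.mem_sigma, mem_factorizations, Fintype.mem_piFinset] at h ⊢
    simp only [comp_joinArgs, h.2, h.1, and_self]
  · rintro ⟨⟨z, v⟩, q⟩ h ⟨⟨z', v'⟩, q'⟩ h' heq
    obtain ⟨y, w, rfl⟩ : ∃ (y : Fin (O.arity z) → O.carrier)
        (w : ∀ i, Fin (O.arity (y i)) → O.carrier), q = fun i => ⟨y i, w i⟩ := ⟨_, _, rfl⟩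
    obtain ⟨y', w', rfl⟩ : ∃ (y : Fin (O.arity z') → O.carrier)
        (w : ∀ i, Fin (O.arity (y i)) → O.carrier), q' = fun i => ⟨y i, w i⟩ := ⟨_, _, rfl⟩
    simp only [Finset.mem_sigma, mem_factorizations, Fintype.mem_piFinset] at h h'
    obtain rfl : (fun i => O.comp (y i) (w i)) = v := funext h.2
    obtain rfl : (fun i => O.comp (y' i) (w' i)) = v' := funext h'.2
    dsimp only at heq
    obtain ⟨houter, hinner⟩ := Sigma.mk.inj_iff.1 heq
    obtain ⟨rfl, hy⟩ := Sigma.mk.inj_iff.1 (eq_of_heq hinner)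
    obtain rfl : y = y' := eq_of_heq hy
    obtain rfl : w = w' := (joinArgs _ _).injective (eq_of_heq (Sigma.mk.inj_iff.1 houter).2)
    rfl
  · rintro ⟨⟨_, v⟩, ⟨z, y⟩⟩ h
    simp only [Finset.mem_sigma, mem_factorizations] at h
    obtain ⟨h, rfl⟩ := h
    obtain ⟨w, rfl⟩ := (joinArgs z y).surjective v
    refine ⟨⟨⟨z, fun i => O.comp (y i) (w i)⟩, fun i => ⟨y i, w i⟩⟩, ?_, rfl⟩
    simp only [Finset.mem_sigma, mem_factorizations, Fintype.mem_piFinset]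
    exact ⟨(comp_joinArgs z y w).symm.trans h, fun _ => trivial⟩

theorem prod_letter_joinArgs (x : O.carrier) (y : Fin (O.arity x) → O.carrier)
    (z : ∀ i, Fin (O.arity (y i)) → O.carrier) :
    (List.ofFn fun l => letter K (joinArgs x y z l)).prod =
      (List.ofFn fun i => (List.ofFn fun j => letter K (z i j)).prod).prod := by
  rw [← elem_rd_ofFn, ofFn_joinArgs, elem_rd, List.map_flatten, List.prod_flatten]
  simp only [List.map_ofFn, Function.comp_def]

theorem comul_coassoc (hO : O.FinitelyFactorizable) {deg : O.carrier → ℕ} (h : O.IsGrading deg) :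
    (Algebra.TensorProduct.assoc K K K _ _ _).toAlgHom.comp
        ((Algebra.TensorProduct.map (comul K O) (.id K (NatAlg K O))).comp (comul K O)) =
      (Algebra.TensorProduct.map (.id K _) (comul K O)).comp (comul K O) := by
  refine natAlg_algHom_ext fun x => ?_
  simp only [AlgHom.comp_apply, AlgEquiv.coe_toAlgHom,
    comul_letter K hO h, map_sum, Algebra.TensorProduct.map_tmul, AlgHom.id_apply, map_prod_ofFn,
    TensorProduct.sum_tmul, Algebra.TensorProduct.assoc_tmul]
  rw [sum_factorizations_assoc hO fun p q => letter K q.1 ⊗ₜ[K]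
    ((List.ofFn fun i => letter K (q.2 i)).prod ⊗ₜ[K] (List.ofFn fun i => letter K (p.2 i)).prod)]
  refine Finset.sum_congr rfl fun p _ => ?_
  simp only [prod_ofFn_sum, prod_ofFn_tmul, prod_letter_joinArgs, TensorProduct.tmul_sum]

theorem comp_unit_eq_iff (p : O.Composite) (x : O.carrier) :
    O.comp p.1 p.2 = x ∧ p.1 = O.unit ↔ p = ⟨O.unit, fun _ => x⟩ := by
  refine ⟨?_, by rintro rfl; exact ⟨O.unit_comp x, rfl⟩⟩
  obtain ⟨y, z⟩ := p
  rintro ⟨rfl, rfl⟩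
  have hz : z = fun _ => z (Fin.cast O.arity_unit.symm 0) := funext fun i => congrArg z <|
    Fin.ext (by have := i.2; have := O.arity_unit; simp; omega)
  rw [hz, O.unit_comp]

theorem counit_rTensor (hO : O.FinitelyFactorizable) {deg : O.carrier → ℕ}
    (h : O.IsGrading deg) :
    (Algebra.TensorProduct.map (counit K O) (.id K (NatAlg K O))).comp (comul K O) =
      (Algebra.TensorProduct.lid K _).symm.toAlgHom := by
  classical
  refine natAlg_algHom_ext fun x => ?_
  simp only [AlgHom.comp_apply, comul_letter K hO h, map_sum, Algebra.TensorProduct.map_tmul,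
    AlgHom.id_apply, counit_letter, TensorProduct.ite_tmul,
    ← Finset.sum_filter]
  have hfilter : {p ∈ factorizations hO x.1 | p.1 = O.unit} = {⟨O.unit, fun _ => x.1⟩} := by
    ext p
    rw [Finset.mem_filter, mem_factorizations, comp_unit_eq_iff, Finset.mem_singleton]
  simp only [hfilter, Finset.sum_singleton, List.ofFn_const, List.prod_replicate, O.arity_unit,
    pow_one]
  rfl

theorem counit_lTensor (hO : O.FinitelyFactorizable) {deg : O.carrier → ℕ}
    (h : O.IsGrading deg) :
    (Algebra.TensorProduct.map (.id K (NatAlg K O)) (counit K O)).comp (comul K O) =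
      (Algebra.TensorProduct.rid K K _).symm.toAlgHom := by
  classical
  refine natAlg_algHom_ext fun x => ?_
  simp only [AlgHom.comp_apply, comul_letter K hO h, map_sum, Algebra.TensorProduct.map_tmul,
    AlgHom.id_apply, map_prod_ofFn, counit_letter, List.prod_ofFn, Finset.prod_ite_zero,
    Finset.prod_const_one, TensorProduct.tmul_ite, Finset.mem_univ,
    true_implies, ← Finset.sum_filter]
  have hfilter : {p ∈ factorizations hO x.1 | ∀ i, p.2 i = O.unit} =
      {⟨x.1, fun _ => O.unit⟩} := by
    ext ⟨y, z⟩
    rw [Finset.mem_filter, mem_factorizations, Finset.mem_singleton]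
    refine ⟨fun ⟨hp, hz⟩ => ?_, ?_⟩
    · obtain rfl : z = fun _ => O.unit := funext hz
      rw [← hp, O.comp_unit]
    · rintro ⟨⟩
      exact ⟨O.comp_unit _, fun _ => rfl⟩
  rw [hfilter, Finset.sum_singleton]
  rfl

end Coalgebra

section Antipode

variable {R H ι : Type*} [CommRing R] [Ring H] [Algebra R H] [Coalgebra R H]

/-- A basis whose elements have degrees for which the coproduct is homogeneous. -/
def IsGradedBasis (b : Module.Basis ι R H) (deg : ι → ℕ) : Prop :=
  ∀ i, Coalgebra.comul (R := R) (b i) ∈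
    Submodule.span R {x | ∃ j k, deg j + deg k = deg i ∧ b j ⊗ₜ[R] b k = x}

variable {b : Module.Basis ι R H} {deg : ι → ℕ}

theorem IsGradedBasis.convMul_congr (hb : IsGradedBasis b deg)
    {f f' g g' : WithConv (H →ₗ[R] H)} {i : ι}
    (h : ∀ j k, deg j + deg k = deg i →
      f.ofConv (b j) * g.ofConv (b k) = f'.ofConv (b j) * g'.ofConv (b k)) :
    (f * g).ofConv (b i) = (f' * g').ofConv (b i) := by
  have hspan : Set.EqOn (LinearMap.mul' R H ∘ₗ TensorProduct.map f.ofConv g.ofConv)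
      (LinearMap.mul' R H ∘ₗ TensorProduct.map f'.ofConv g'.ofConv)
      (Submodule.span R {x | ∃ j k, deg j + deg k = deg i ∧ b j ⊗ₜ[R] b k = x}) := by
    refine LinearMap.eqOn_span ?_
    rintro _ ⟨j, k, hjk, rfl⟩
    simpa using h j k hjk
  exact hspan (hb i)

theorem IsGradedBasis.pow_apply_eq_zero (hb : IsGradedBasis b deg) {f : WithConv (H →ₗ[R] H)}
    (hf : ∀ i, deg i = 0 → f.ofConv (b i) = 0) (n : ℕ) (i : ι) (hi : deg i < n) :
    (f ^ n).ofConv (b i) = 0 := by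
  induction n generalizing i with
  | zero => omega
  | succ n ih =>
    have hmul : (f * f ^ n).ofConv (b i) = ((0 : WithConv (H →ₗ[R] H)) * 0).ofConv (b i) := by
      refine hb.convMul_congr fun j k hjk => ?_
      by_cases hj : deg j = 0
      · simp [hf j hj]
      · simp [ih k (by omega)]
    simpa [pow_succ'] using hmul

/-- The antipode is the geometric series `∑ (1 - id)ᵏ` for the convolution product, which is
finite on each basis element because `1 - id` vanishes in degree `0`. -/
theorem IsGradedBasis.exists_antipode (hb : IsGradedBasis b deg)
    (h0 : ∀ i, deg i = 0 → algebraMap R H (Coalgebra.counit (R := R) (b i)) = b i) :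
    ∃ σ : WithConv (H →ₗ[R] H), σ * .toConv .id = 1 ∧ .toConv .id * σ = 1 := by
  let J : WithConv (H →ₗ[R] H) := 1 - .toConv .id
  have hid : (.toConv .id : WithConv (H →ₗ[R] H)) = 1 - J := (sub_sub_cancel _ _).symm
  have hJ : ∀ n i, deg i < n → (J ^ n).ofConv (b i) = 0 :=
    hb.pow_apply_eq_zero fun i hi => sub_eq_zero.2 (h0 i hi)
  let G : ℕ → WithConv (H →ₗ[R] H) := fun n => ∑ k ∈ Finset.range (n + 1), J ^ k
  let σ : WithConv (H →ₗ[R] H) := .toConv (b.constr R fun i => (G (deg i)).ofConv (b i))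
  have hσ : ∀ n i, deg i ≤ n → σ.ofConv (b i) = (G n).ofConv (b i) := by
    intro n i hi
    refine (b.constr_basis R _ i).trans ?_
    induction n, hi using Nat.le_induction with
    | base => rfl
    | succ n hn ih =>
      rw [ih, show G (n + 1) = G n + J ^ (n + 1) from Finset.sum_range_succ _ _,
        WithConv.ofConv_add, LinearMap.add_apply, hJ _ _ (by omega), add_zero]
  have hone : ∀ i, (1 - J ^ (deg i + 1)).ofConv (b i) =
      (1 : WithConv (H →ₗ[R] H)).ofConv (b i) := fun i => by
    rw [WithConv.ofConv_sub, LinearMap.sub_apply, hJ _ _ (Nat.lt_succ_self _), sub_zero]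
  refine ⟨σ, WithConv.ext (b.ext fun i => ?_), WithConv.ext (b.ext fun i => ?_)⟩
  · rw [hb.convMul_congr (f' := G (deg i)) (g' := .toConv .id), hid, geom_sum_mul_neg, hone]
    intro j k hjk
    rw [hσ (deg i) j (by omega)]
  · rw [hb.convMul_congr (f' := .toConv .id) (g' := G (deg i)), hid, mul_neg_geom_sum, hone]
    intro j k hjk
    rw [hσ (deg i) k (by omega)]

end Antipode

section Degree

variable (K : Type v) [Field K] {O : Operad.{u}} {deg : O.carrier → ℕ}

/-- The degree of a reduced word: the sum of the degrees of its letters. -/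
def wordDegree (deg : O.carrier → ℕ) (w : O.RWord) : ℕ := (w.word.map deg).sum

theorem wordDegree_mul (w w' : O.RWord) :
    wordDegree deg (w * w') = wordDegree deg w + wordDegree deg w' := by
  simp [wordDegree, Operad.RWord.word, FreeMonoid.toList_mul]

theorem wordDegree_of (x : O.NonUnit) : wordDegree deg (FreeMonoid.of x) = deg x.1 := by
  simp [wordDegree, Operad.RWord.word, FreeMonoid.toList_of]

theorem wordDegree_rd (h : O.IsGrading deg) (l : List O.carrier) :
    wordDegree deg (O.rd l) = (l.map deg).sum := by
  induction l with
  | nil => rfl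
  | cons x l ih =>
    rw [Operad.rd_cons, wordDegree_mul, ih, List.map_cons, List.sum_cons]
    congr 1
    by_cases hx : x = O.unit
    · rw [hx, Operad.rd_unit, (h.eq_zero_iff _).2 rfl]
      rfl
    · rw [Operad.rd_singleton ⟨x, hx⟩, wordDegree_of]

theorem eq_one_of_wordDegree_eq_zero (h : O.IsGrading deg) {w : O.RWord}
    (hw : wordDegree deg w = 0) : w = 1 := by
  cases w using FreeMonoid.casesOn with
  | one => rfl
  | of_mul x w =>
    rw [wordDegree_mul, wordDegree_of] at hw
    exact absurd ((h.eq_zero_iff _).1 (by omega)) x.2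

theorem comul_letter_mem_span (hO : O.FinitelyFactorizable) (h : O.IsGrading deg)
    (x : O.carrier) :
    comul K O (letter K x) ∈ Submodule.span K {z | ∃ a b,
      wordDegree deg a + wordDegree deg b = deg x ∧ elem K a ⊗ₜ[K] elem K b = z} := by
  rw [comul_letter K hO h]
  refine Submodule.sum_mem _ fun p hp => Submodule.subset_span
    ⟨O.rd [p.1], O.rd (List.ofFn p.2), ?_, ?_⟩
  · rw [← Operad.mem_factorizations.1 hp, h.comp, wordDegree_rd h, wordDegree_rd h, List.map_ofFn,
      List.sum_ofFn, List.map_singleton, List.sum_singleton]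
    rfl
  · rw [elem_rd_ofFn, letter]

theorem comul_elem_mem_span (hO : O.FinitelyFactorizable) (h : O.IsGrading deg) (w : O.RWord) :
    comul K O (elem K w) ∈ Submodule.span K {z | ∃ a b,
      wordDegree deg a + wordDegree deg b = wordDegree deg w ∧ elem K a ⊗ₜ[K] elem K b = z} := by
  induction w using FreeMonoid.inductionOn' with
  | one =>
    rw [elem_one, map_one]
    exact Submodule.subset_span ⟨1, 1, rfl, rfl⟩
  | of_mul x w ih =>
    rw [elem_mul, map_mul, ← letter_nonUnit]
    have hmem := Submodule.mul_mem_mul (comul_letter_mem_span K hO h x.1) ih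
    rw [Submodule.span_mul_span] at hmem
    refine Submodule.span_mono ?_ hmem
    rintro _ ⟨_, ⟨a, b, hab, rfl⟩, _, ⟨a', b', hab', rfl⟩, rfl⟩
    refine ⟨a * a', b * b', ?_, ?_⟩
    · rw [wordDegree_mul, wordDegree_mul, wordDegree_mul, wordDegree_of]
      omega
    · simp only [elem_mul, Algebra.TensorProduct.tmul_mul_tmul]

theorem isHopfAlgebra_natAlg (hO : O.FinitelyFactorizable) (h : O.IsGrading deg) :
    IsHopfAlgebra (comul K O) (counit K O) := by
  let C : Coalgebra K (NatAlg K O) := (Bialgebra.ofAlgHom (comul K O) (counit K O)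
    (comul_coassoc K hO h) (counit_rTensor K hO h) (counit_lTensor K hO h)).toCoalgebra
  have hb : IsGradedBasis (MonoidAlgebra.basis O.RWord K) (wordDegree deg) := fun w => by
    simpa [elem] using! comul_elem_mem_span K hO h w
  obtain ⟨σ, hleft, hright⟩ := hb.exists_antipode fun w hw => by
    rw [eq_one_of_wordDegree_eq_zero h hw]
    exact (congrArg _ (map_one (counit K O))).trans (map_one _)
  exact ⟨C.coassoc, C.rTensor_counit_comp_comul, C.lTensor_counit_comp_comul, σ.ofConv,
    congrArg WithConv.ofConv hleft, congrArg WithConv.ofConv hright⟩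

end Degree

section Flatten

theorem sum_Iio_succ {n : ℕ} (d : Fin (n + 1) → ℕ) (k : Fin n) :
    ∑ k' ∈ Finset.Iio k.succ, d k' = d 0 + ∑ k' ∈ Finset.Iio k, d k'.succ := by
  simp only [← Finset.filter_gt_eq_Iio, Finset.sum_filter, Fin.sum_univ_succ, Fin.succ_pos,
    if_true, Fin.succ_lt_succ_iff]

variable {α : Type*} {n : ℕ} (l : Fin n → List α)

theorem sum_length_Iio (k : Fin n) :
    ∑ k' ∈ Finset.Iio k, (l k').length = ((List.ofFn l).take k).flatten.length := by
  rw [List.length_flatten, List.map_take, List.map_ofFn, List.sum_take_ofFn]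
  exact Finset.sum_congr (by ext; simp) fun _ _ => rfl

theorem drop_flatten_ofFn_append (k : Fin n) (v : List α) :
    ∃ v', ((List.ofFn l).flatten ++ v).drop (∑ k' ∈ Finset.Iio k, (l k').length) = l k ++ v' := by
  refine ⟨((List.ofFn l).drop (k + 1)).flatten ++ v, ?_⟩
  have hk : (k : ℕ) < (List.ofFn l).length := by simp
  rw [sum_length_Iio, ← List.take_append_drop k (List.ofFn l), List.flatten_append,
    List.take_append_drop, List.append_assoc, List.drop_left, List.drop_eq_getElem_cons hk,
    List.flatten_cons, List.getElem_ofFn, List.append_assoc]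

theorem exists_flatten_ofFn {d : Fin n → ℕ} {w : List α} (hw : w.length = ∑ k, d k) :
    ∃ l : Fin n → List α, (List.ofFn l).flatten = w ∧ ∀ k, (l k).length = d k := by
  induction n generalizing w with
  | zero => exact ⟨Fin.elim0, by simpa [eq_comm] using hw, fun k => k.elim0⟩
  | succ n ih =>
    rw [Fin.sum_univ_succ] at hw
    obtain ⟨l, hl, hlen⟩ := ih (w := w.drop (d 0)) (d := fun k => d k.succ) (by simp; omega)
    refine ⟨Fin.cons (w.take (d 0)) l, by simp [List.ofFn_succ, hl], Fin.cases ?_ ?_⟩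
    · simp; omega
    · simpa using hlen

theorem getElem?_flatten_ofFn_eq_some {i : ℕ} {x : α} : (List.ofFn l).flatten[i]? = some x ↔
    ∃ k j, i = ∑ k' ∈ Finset.Iio k, (l k').length + j ∧ (l k)[j]? = some x := by
  constructor
  · intro h
    induction n generalizing i with
    | zero => simp at h
    | succ n ih =>
      rw [List.ofFn_succ, List.flatten_cons, List.getElem?_append] at h
      split_ifs at h with hi
      · exact ⟨0, i, by simp, h⟩
      · obtain ⟨k, j, hij, hx⟩ := ih _ h
        refine ⟨k.succ, j, ?_, hx⟩
        rw [sum_Iio_succ]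
        omega
  · rintro ⟨k, j, rfl, hx⟩
    obtain ⟨v, hv⟩ := drop_flatten_ofFn_append l k []
    rw [← List.append_nil (List.ofFn l).flatten, ← List.getElem?_drop, hv,
      List.getElem?_append_left (List.getElem?_eq_some_iff.1 hx).1, hx]

theorem ofFn_eq_append_cons {t : Fin n → α} {x : α} {l₁ l₂ : List α} :
    List.ofFn t = l₁ ++ x :: l₂ ↔
      ∃ k : Fin n, l₁ = (List.ofFn t).take k ∧ x = t k ∧ l₂ = (List.ofFn t).drop (k + 1) := by
  constructor
  · intro h
    have hlen : l₁.length < n := by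
      rw [← List.length_ofFn (f := t), h]
      simp
    refine ⟨⟨l₁.length, hlen⟩, ?_, ?_, ?_⟩
    · simp [h]
    · rw [← List.getElem_ofFn (f := t) (by simpa)]
      simp [h]
    · simp [h, List.drop_append]
  · rintro ⟨k, rfl, rfl, rfl⟩
    rw [← List.getElem_ofFn (f := t) (by simp), List.getElem_cons_drop, List.take_append_drop]

end Flatten

theorem mem_prod_ofFn_language {α : Type*} {n : ℕ} {L : Fin n → Language α} {w : List α} :
    w ∈ (List.ofFn L).prod ↔
      ∃ l : Fin n → List α, (∀ k, l k ∈ L k) ∧ (List.ofFn l).flatten = w := by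
  induction n generalizing w with
  | zero => simp [Language.mem_one, eq_comm]
  | succ n ih =>
    rw [List.ofFn_succ, List.prod_cons, Language.mem_mul]
    constructor
    · rintro ⟨u, hu, v, hv, rfl⟩
      obtain ⟨l, hl, rfl⟩ := ih.1 hv
      exact ⟨Fin.cons u l, Fin.cases hu hl, by simp [List.ofFn_succ]⟩
    · rintro ⟨l, hl, rfl⟩
      exact ⟨l 0, hl 0, _, ih.2 ⟨_, fun k => hl k.succ, rfl⟩, by simp [List.ofFn_succ]⟩

section Compatible

variable {S : Signature.{u}} {A : ForestAlphabet S.carrier}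

open ForestAlphabet

namespace STerm

/-- The words compatible with a term when the condition imposed on the letter of its root is `P`
instead of `R`. -/
def language (A : ForestAlphabet S.carrier) : STerm S → (A.carrier → Prop) → Language A.carrier
  | leaf, _ => 1
  | node s t, P => {w | ∃ a v, w = a :: v ∧ P a ∧ IsDec A s a ∧
      v ∈ (List.ofFn fun k => (t k).language A (IsEdge A k.val.succPNat a)).prod}

theorem mem_language_node {s : S.carrier} {t : Fin (S.arity s) → STerm S} {P : A.carrier → Prop}
    {w : List A.carrier} : w ∈ (node s t).language A P ↔ ∃ a v, w = a :: v ∧ P a ∧ IsDec A s a ∧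
      v ∈ (List.ofFn fun k => (t k).language A (IsEdge A k.val.succPNat a)).prod :=
  Iff.rfl

theorem length_of_mem_language {t : STerm S} {P : A.carrier → Prop} {w : List A.carrier}
    (hw : w ∈ t.language A P) : w.length = t.degree := by
  induction t generalizing P w with
  | leaf => exact congrArg List.length hw
  | node s t ih =>
    obtain ⟨a, v, rfl, -, -, hv⟩ := hw
    obtain ⟨l, hl, rfl⟩ := mem_prod_ofFn_language.1 hv
    simp [degree, List.sum_ofFn, ih _ (hl _), add_comm]

theorem length_decorations (t : STerm S) : t.decorations.length = t.degree := by
  induction t with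
  | leaf => rfl
  | node s t ih => simp [degree, decorations, List.sum_ofFn, ih, add_comm]

/-- The first letters of `w`, as far as they exist, satisfy the conditions for being the letters
of the internal nodes of `t`, with `P` imposed on the letter of the root instead of `R`. -/
structure CompatibleWith (t : STerm S) (P : A.carrier → Prop) (w : List A.carrier) : Prop where
  root : t ≠ leaf → ∀ a, w[0]? = some a → P a
  dec : ∀ (i : ℕ) s a, t.decorations[i]? = some s → w[i]? = some a → IsDec A s a
  edge : ∀ j (i i' : ℕ) a a', t.Edge j i i' → w[i]? = some a → w[i']? = some a' → IsEdge A j a a'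

theorem getElem?_decorations_node_succ {s s' : S.carrier} {t : Fin (S.arity s) → STerm S}
    {i : ℕ} : (node s t).decorations[i + 1]? = some s' ↔
      ∃ k j, i = ∑ k' ∈ Finset.Iio k, (t k').degree + j ∧ (t k).decorations[j]? = some s' := by
  simp only [decorations, List.getElem?_cons_succ, getElem?_flatten_ofFn_eq_some,
    length_decorations]

theorem compatibleWith_node {s : S.carrier} {t : Fin (S.arity s) → STerm S} {P : A.carrier → Prop}
    {a : A.carrier} {w : List A.carrier} :
    (node s t).CompatibleWith P (a :: w) ↔ P a ∧ IsDec A s a ∧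
      ∀ k, (t k).CompatibleWith (IsEdge A k.val.succPNat a)
        (w.drop (∑ k' ∈ Finset.Iio k, (t k').degree)) := by
  have getElem?_offset (k : Fin (S.arity s)) (i : ℕ) : (a :: w)[offset t k + i]? =
      (w.drop (∑ k' ∈ Finset.Iio k, (t k').degree))[i]? := by
    rw [offset, add_assoc, add_comm 1, List.getElem?_cons_succ, List.getElem?_drop]
  constructor
  · refine fun h => ⟨h.root nofun a rfl, h.dec 0 s a rfl rfl, fun k => ⟨fun hk a' ha' => ?_,
      fun i s' a' hs' ha' => ?_, fun j i i' a' a'' he ha' ha'' => ?_⟩⟩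
    · exact h.edge _ _ _ a a' (.root s t k hk) rfl (by rw [← ha', ← getElem?_offset]; rfl)
    · rw [List.getElem?_drop, ← List.getElem?_cons_succ (a := a)] at ha'
      exact h.dec _ s' a' (getElem?_decorations_node_succ.2 ⟨k, i, rfl, hs'⟩) ha'
    · exact h.edge j _ _ a' a'' (.child s t k j i i' he) ((getElem?_offset k i).trans ha')
        ((getElem?_offset k i').trans ha'')
  · rintro ⟨hP, hs, h⟩
    refine ⟨?_, ?_, ?_⟩
    · rintro - _ ⟨⟩
      exact hP
    · rintro (_ | i) s' a' hs' ha'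
      · obtain rfl : s = s' := Option.some_injective _ hs'
        obtain rfl : a = a' := Option.some_injective _ ha'
        exact hs
      · obtain ⟨k, j, rfl, hj⟩ := getElem?_decorations_node_succ.1 hs'
        exact (h k).dec j s' a' hj (by rw [List.getElem?_drop]; exact ha')
    · rintro j _ _ a' a'' (⟨_, _, k, hk⟩ | ⟨_, _, k, _, i, i', he⟩) ha' ha''
      · obtain rfl : a = a' := Option.some_injective _ ha'
        exact (h k).root hk a'' ((getElem?_offset k 0).symm.trans ha'')
      · exact (h k).edge j i i' a' a'' he ((getElem?_offset k i).symm.trans ha')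
          ((getElem?_offset k i').symm.trans ha'')

theorem mem_prod_language_iff_of_forall {n : ℕ} {t : Fin n → STerm S} {P : Fin n → A.carrier → Prop}
    (ht : ∀ k w v, w ∈ (t k).language A (P k) ↔
      w.length = (t k).degree ∧ (t k).CompatibleWith (P k) (w ++ v))
    {w : List A.carrier} (v : List A.carrier) :
    w ∈ (List.ofFn fun k => (t k).language A (P k)).prod ↔ w.length = ∑ k, (t k).degree ∧
      ∀ k, (t k).CompatibleWith (P k)
        ((w ++ v).drop (∑ k' ∈ Finset.Iio k, (t k').degree)) := by
  rw [mem_prod_ofFn_language]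
  have drop_eq {l : Fin n → List A.carrier} (hl : ∀ k, (l k).length = (t k).degree) (k : Fin n) :
      ∃ v', ((List.ofFn l).flatten ++ v).drop (∑ k' ∈ Finset.Iio k, (t k').degree) =
        l k ++ v' := by
    simpa only [hl] using drop_flatten_ofFn_append l k v
  constructor
  · rintro ⟨l, hl, rfl⟩
    have hlen : ∀ k, (l k).length = (t k).degree := fun k => length_of_mem_language (hl k)
    refine ⟨by simp [List.sum_ofFn, hlen], fun k => ?_⟩
    obtain ⟨v', hv'⟩ := drop_eq hlen k
    exact hv' ▸ ((ht k _ v').1 (hl k)).2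
  · rintro ⟨hw, h⟩
    obtain ⟨l, rfl, hlen⟩ := exists_flatten_ofFn hw
    refine ⟨l, fun k => ?_, rfl⟩
    obtain ⟨v', hv'⟩ := drop_eq hlen k
    exact (ht k _ v').2 ⟨hlen k, hv' ▸ h k⟩

theorem mem_language_iff {t : STerm S} {P : A.carrier → Prop} {w : List A.carrier}
    (v : List A.carrier) :
    w ∈ t.language A P ↔ w.length = t.degree ∧ t.CompatibleWith P (w ++ v) := by
  induction t generalizing P w v with
  | leaf =>
    exact ⟨fun h => ⟨congrArg List.length h, ⟨fun h => absurd rfl h, nofun, nofun⟩⟩,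
      fun h => List.eq_nil_of_length_eq_zero h.1⟩
  | node s t ih =>
    rw [mem_language_node]
    obtain - | ⟨a, w⟩ := w
    · exact ⟨nofun, fun h => absurd h.1 (by simp only [degree, List.length_nil]; omega)⟩
    · simp only [List.cons.injEq, ↓existsAndEq, true_and,
        mem_prod_language_iff_of_forall (fun k _ v => ih k v) v, List.cons_append,
        compatibleWith_node, degree, List.length_cons]
      grind

theorem mem_prod_language_iff {n : ℕ} {t : Fin n → STerm S} {P : Fin n → A.carrier → Prop}
    {w : List A.carrier} :
    w ∈ (List.ofFn fun k => (t k).language A (P k)).prod ↔ w.length = ∑ k, (t k).degree ∧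
      ∀ k, (t k).CompatibleWith (P k) (w.drop (∑ k' ∈ Finset.Iio k, (t k').degree)) := by
  simpa only [List.append_nil] using
    mem_prod_language_iff_of_forall (fun _ _ => mem_language_iff) ([] : List A.carrier)

end STerm

namespace Forest

theorem degree_take_ofFn {n : ℕ} (t : Fin n → STerm S) (k : Fin n) :
    degree ((List.ofFn t).take k) = ∑ k' ∈ Finset.Iio k, (t k').degree := by
  rw [degree, List.map_take, List.map_ofFn, List.sum_take_ofFn]
  exact Finset.sum_congr (by ext; simp) fun _ _ => rfl

theorem isRoot_ofFn {n : ℕ} {t : Fin n → STerm S} {i : ℕ} :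
    IsRoot (List.ofFn t) i ↔
      ∃ k, t k ≠ .leaf ∧ i = ∑ k' ∈ Finset.Iio k, (t k').degree := by
  simp only [IsRoot, ofFn_eq_append_cons]
  constructor
  · rintro ⟨_, _, _, ⟨k, rfl, rfl, rfl⟩, hk, rfl⟩
    exact ⟨k, hk, degree_take_ofFn t k⟩
  · rintro ⟨k, hk, rfl⟩
    exact ⟨_, _, _, ⟨k, rfl, rfl, rfl⟩, hk, (degree_take_ofFn t k).symm⟩

theorem edge_ofFn {n : ℕ} {t : Fin n → STerm S} {j : ℕ+} {i i' : ℕ} :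
    Edge (List.ofFn t) j i i' ↔ ∃ k l l', (t k).Edge j l l' ∧
      i = ∑ k' ∈ Finset.Iio k, (t k').degree + l ∧
      i' = ∑ k' ∈ Finset.Iio k, (t k').degree + l' := by
  simp only [Edge, ofFn_eq_append_cons]
  constructor
  · rintro ⟨_, _, _, l, l', ⟨k, rfl, rfl, rfl⟩, he, rfl, rfl⟩
    exact ⟨k, l, l', he, by rw [degree_take_ofFn], by rw [degree_take_ofFn]⟩
  · rintro ⟨k, l, l', he, rfl, rfl⟩
    exact ⟨_, _, _, l, l', ⟨k, rfl, rfl, rfl⟩, he, by rw [degree_take_ofFn],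
      by rw [degree_take_ofFn]⟩

theorem getElem?_decorations_ofFn {n : ℕ} {t : Fin n → STerm S} {i : ℕ} {s : S.carrier} :
    (decorations (List.ofFn t))[i]? = some s ↔
      ∃ k j, i = ∑ k' ∈ Finset.Iio k, (t k').degree + j ∧ (t k).decorations[j]? = some s := by
  simp only [decorations, List.flatMap_def, List.map_ofFn, getElem?_flatten_ofFn_eq_some,
    Function.comp_apply, STerm.length_decorations]

theorem compatible_ofFn_iff {n : ℕ} {t : Fin n → STerm S} {w : List A.carrier} :
    Compatible (List.ofFn t) A w ↔ w.length = ∑ k, (t k).degree ∧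
      ∀ k, (t k).CompatibleWith (ForestAlphabet.IsRoot A)
        (w.drop (∑ k' ∈ Finset.Iio k, (t k').degree)) := by
  have hdeg : degree (List.ofFn t) = ∑ k, (t k).degree := by
    rw [degree, List.map_ofFn, List.sum_ofFn]
    rfl
  constructor
  · refine fun h => ⟨h.length.trans hdeg, fun k => ⟨fun hk a ha => ?_, fun i s a hs ha => ?_,
      fun j i i' a a' he ha ha' => ?_⟩⟩
    all_goals simp only [List.getElem?_drop] at *
    · exact h.root _ a (isRoot_ofFn.2 ⟨k, hk, rfl⟩) ha
    · exact h.dec _ a s (getElem?_decorations_ofFn.2 ⟨k, i, rfl, hs⟩) ha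
    · exact h.edge j _ _ a a' (edge_ofFn.2 ⟨k, i, i', he, rfl, rfl⟩) ha ha'
  · rintro ⟨hw, h⟩
    refine ⟨hw.trans hdeg.symm, fun i a hi ha => ?_, fun i a s hs ha => ?_,
      fun j i i' a a' he ha ha' => ?_⟩
    · obtain ⟨k, hk, rfl⟩ := isRoot_ofFn.1 hi
      exact (h k).root hk a (by rwa [List.getElem?_drop])
    · obtain ⟨k, l, rfl, hl⟩ := getElem?_decorations_ofFn.1 hs
      exact (h k).dec l s a hl (by rwa [List.getElem?_drop])
    · obtain ⟨k, l, l', hl, rfl, rfl⟩ := edge_ofFn.1 he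
      exact (h k).edge j l l' a a' hl (by rwa [List.getElem?_drop]) (by rwa [List.getElem?_drop])

theorem compatible_iff_mem_language {f : Forest S} {w : List A.carrier} :
    Compatible f A w ↔ w ∈ (f.map fun t => t.language A (ForestAlphabet.IsRoot A)).prod := by
  rw [← List.ofFn_get f, compatible_ofFn_iff, List.map_ofFn]
  exact STerm.mem_prod_language_iff.symm

end Forest

end Compatible

section Series

variable {K : Type v} [Field K] {α : Type u}

open scoped Classical in
/-- The pairs of words with concatenation `w`. -/
def splits (w : List α) : Finset (List α × List α) :=
  (Finset.range (w.length + 1)).image fun i => (w.take i, w.drop i)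

theorem mem_splits {w : List α} {p : List α × List α} : p ∈ splits w ↔ p.1 ++ p.2 = w := by
  simp only [splits, Finset.mem_image, Finset.mem_range]
  constructor
  · rintro ⟨i, -, rfl⟩
    exact List.take_append_drop i w
  · rintro rfl
    exact ⟨p.1.length, by simp, by simp⟩

theorem conv_eq_sum_splits (f g : List α → K) (w : List α) :
    Poly.conv f g w = ∑ p ∈ splits w, f p.1 * g p.2 := by
  classical
  rw [splits, Finset.sum_image, Poly.conv]
  intro i hi j hj hij
  have := congrArg (fun p => p.1.length) hij
  simp only [List.length_take, Finset.coe_range, Set.mem_Iio] at this hi hj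
  omega

open scoped Classical in
/-- The characteristic series of a language. -/
def charSeries (K : Type v) [Field K] (L : Language α) (w : List α) : K := if w ∈ L then 1 else 0

theorem charSeries_one : charSeries K (1 : Language α) = Poly.delta := by
  funext w
  cases w <;> simp [charSeries, Language.mem_one, Poly.delta]

theorem conv_charSeries {L M : Language α} {n : ℕ} (hL : ∀ w ∈ L, w.length = n) :
    Poly.conv (charSeries K L) (charSeries K M) = charSeries K (L * M) := by
  funext w
  rw [conv_eq_sum_splits]
  by_cases hw : w ∈ L * M
  · obtain ⟨u, hu, v, hv, rfl⟩ := Language.mem_mul.1 hw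
    rw [Finset.sum_eq_single (u, v)]
    · simp [charSeries, hu, hv, hw]
    · rintro ⟨u', v'⟩ hsplit hne
      rw [charSeries, if_neg, zero_mul]
      intro hu'
      exact hne (Prod.ext_iff.2
        (List.append_inj (mem_splits.1 hsplit) ((hL u' hu').trans (hL u hu).symm)))
    · exact fun h => absurd (mem_splits.2 rfl) h
  · rw [charSeries, if_neg hw]
    refine Finset.sum_eq_zero fun p hp => ?_
    rw [mem_splits] at hp
    by_cases h₁ : p.1 ∈ L
    · rw [charSeries, charSeries, if_neg (c := p.2 ∈ M), mul_zero]
      exact fun h₂ => hw (Language.mem_mul.2 ⟨_, h₁, _, h₂, hp⟩)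
    · rw [charSeries, if_neg h₁, zero_mul]

theorem coe_prod_map_charSeries {ι : Type*} {f : ι → Poly K α} {L : ι → Language α} {n : ι → ℕ}
    (hf : ∀ i, (f i).1 = charSeries K (L i)) (hL : ∀ i, ∀ w ∈ L i, w.length = n i) (l : List ι) :
    (l.map f).prod.1 = charSeries K (l.map L).prod := by
  induction l with
  | nil => exact charSeries_one.symm
  | cons i l ih =>
    rw [List.map_cons, List.prod_cons, List.map_cons, List.prod_cons, ← conv_charSeries (hL i),
      ← hf, ← ih]
    rfl

open scoped Classical in
/-- The series `∑ a • F a`, where `a` ranges over the letters satisfying `P`. -/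
def consSeries (P : α → Prop) (F : α → List α → K) : List α → K
  | [] => 0
  | a :: w => if P a then F a w else 0

end Series

section TermSum

variable (K : Type v) [Field K] {S : Signature.{u}} (A : ForestAlphabet S.carrier)

/-- The sum of the words compatible with a term when the condition imposed on the letter of its
root is `P` instead of `R`. -/
def termSum (P : A.carrier → Prop) (t : STerm S) : Poly K A.carrier :=
  ⟨charSeries K (t.language A P), t.degree, fun _ hw => if_neg fun h =>
    hw.ne' (STerm.length_of_mem_language h)⟩

theorem termSum_leaf (P : A.carrier → Prop) : termSum K A P .leaf = 1 :=
  Subtype.ext charSeries_one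

theorem coe_prod_ofFn_termSum {n : ℕ} (P : Fin n → A.carrier → Prop) (t : Fin n → STerm S) :
    (List.ofFn fun k => termSum K A (P k) (t k)).prod.1 =
      charSeries K (List.ofFn fun k => (t k).language A (P k)).prod := by
  rw [List.ofFn_eq_map, List.ofFn_eq_map]
  exact coe_prod_map_charSeries (fun _ => rfl) (fun _ _ => STerm.length_of_mem_language) _

theorem termSum_node (P : A.carrier → Prop) (s : S.carrier) (t : Fin (S.arity s) → STerm S) :
    (termSum K A P (.node s t)).1 = consSeries (fun a => P a ∧ ForestAlphabet.IsDec A s a)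
      fun a => (List.ofFn fun k => termSum K A
        (ForestAlphabet.IsEdge A k.val.succPNat a) (t k)).prod.1 := by
  funext w
  obtain - | ⟨a, w⟩ := w
  · simp [termSum, charSeries, consSeries, STerm.mem_language_node]
  · have hmem : a :: w ∈ (STerm.node s t).language A P ↔ (P a ∧ ForestAlphabet.IsDec A s a) ∧
        w ∈ (List.ofFn fun k =>
          (t k).language A (ForestAlphabet.IsEdge A k.val.succPNat a)).prod := by
      simp [STerm.mem_language_node, and_assoc]
    rw [consSeries, coe_prod_ofFn_termSum]
    classical
    by_cases h : P a ∧ ForestAlphabet.IsDec A s a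
    · rw [if_pos h]
      exact if_congr (hmem.trans (and_iff_right h)) rfl rfl
    · rw [if_neg h]
      exact if_neg fun hw => h (hmem.1 hw).1

theorem compatibleSum_eq_prod (f : Forest S) :
    compatibleSum K A f = (f.map (termSum K A (ForestAlphabet.IsRoot A))).prod := by
  refine Subtype.ext (Eq.trans (funext fun w => ?_) (coe_prod_map_charSeries (fun _ => rfl)
    (fun _ _ => STerm.length_of_mem_language) f).symm)
  classical
  exact if_congr Forest.compatible_iff_mem_language rfl rfl

/-- The realizing map `r_A` as an algebra morphism, see `realize_eq_realizeHom`. -/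
def realizeHom : NatAlg K (freeOperad S) →ₐ[K] Poly K A.carrier :=
  algLift K (termSum K A (ForestAlphabet.IsRoot A))

theorem realizeHom_letter (t : STerm S) :
    realizeHom K A (letter K t) = termSum K A (ForestAlphabet.IsRoot A) t :=
  algLift_letter (O := freeOperad S) (termSum_leaf K A (ForestAlphabet.IsRoot A)) t

theorem realize_elem (f : (freeOperad S).RWord) :
    realize K A (elem K f) = compatibleSum K A f.word :=
  natLift_elem _ _

theorem realize_eq_realizeHom : realize K A = (realizeHom K A).toLinearMap :=
  natAlg_linearMap_ext fun f => calc
    realize K A (elem K f) = (f.word.map fun t => realizeHom K A (letter K t)).prod := by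
      rw [realize_elem]
      exact (compatibleSum_eq_prod K A f.word).trans
        (congrArg List.prod (List.map_congr_left fun t _ => (realizeHom_letter K A t).symm))
    _ = realizeHom K A (elem K f) := by
      rw [elem_eq_prod, map_list_prod, List.map_map]
      rfl

end TermSum

section Theta

variable {K : Type v} [Field K] {A B : Type u}

theorem theta_apply (f : Poly K (A ⊕ B)) (u : List A) (v : List B) :
    theta K A B f (u, v) = ∑ w ∈ (shuffles_finite u v).toFinset, f.1 w :=
  finsum_mem_eq_finite_toFinset_sum _ (shuffles_finite u v)

theorem toPairs_tmul (f : Poly K A) (g : Poly K B) (p : List A × List B) :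
    toPairs K A B (f ⊗ₜ g) p = f.1 p.1 * g.1 p.2 := rfl

theorem nil_mem_shuffles {u : List A} {v : List B} : [] ∈ shuffles u v ↔ u = [] ∧ v = [] := by
  simp [shuffles, leftPart, rightPart, eq_comm]

theorem inl_cons_mem_shuffles {a : A} {w : List (A ⊕ B)} {u : List A} {v : List B} :
    Sum.inl a :: w ∈ shuffles u v ↔ ∃ u', u = a :: u' ∧ w ∈ shuffles u' v := by
  constructor
  · rintro ⟨rfl, rfl⟩
    exact ⟨leftPart w, rfl, rfl, rfl⟩
  · rintro ⟨_, rfl, rfl, rfl⟩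
    exact ⟨rfl, rfl⟩

theorem inr_cons_mem_shuffles {b : B} {w : List (A ⊕ B)} {u : List A} {v : List B} :
    Sum.inr b :: w ∈ shuffles u v ↔ ∃ v', v = b :: v' ∧ w ∈ shuffles u v' := by
  constructor
  · rintro ⟨rfl, rfl⟩
    exact ⟨rightPart w, rfl, rfl, rfl⟩
  · rintro ⟨_, rfl, rfl, rfl⟩
    exact ⟨rfl, rfl⟩

theorem append_mem_shuffles {w w' : List (A ⊕ B)} {u u' : List A} {v v' : List B}
    (h : w ∈ shuffles u v) (h' : w' ∈ shuffles u' v') :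
    w ++ w' ∈ shuffles (u ++ u') (v ++ v') := by
  obtain ⟨rfl, rfl⟩ := h
  obtain ⟨rfl, rfl⟩ := h'
  simp [shuffles, leftPart, rightPart]

theorem theta_mul (f g : Poly K (A ⊕ B)) (u : List A) (v : List B) :
    theta K A B (f * g) (u, v) = ∑ p ∈ splits u ×ˢ splits v,
      theta K A B f (p.1.1, p.2.1) * theta K A B g (p.1.2, p.2.2) := by
  have conv_eq (w : List (A ⊕ B)) : (f * g).1 w = ∑ q ∈ splits w, f.1 q.1 * g.1 q.2 :=
    conv_eq_sum_splits f.1 g.1 w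
  simp only [theta_apply, conv_eq, Finset.sum_mul_sum, ← Finset.sum_product']
  rw [Finset.sum_sigma', Finset.sum_sigma']
  refine Finset.sum_nbij'
    (fun x => ⟨((leftPart x.2.1, leftPart x.2.2), (rightPart x.2.1, rightPart x.2.2)), x.2⟩)
    (fun y => ⟨y.2.1 ++ y.2.2, y.2⟩) ?_ ?_ ?_ ?_ fun _ _ => rfl
  · rintro ⟨w, q⟩ h
    simp only [Finset.mem_sigma, Set.Finite.mem_toFinset, mem_splits, Finset.mem_product] at h ⊢
    obtain ⟨⟨rfl, rfl⟩, rfl⟩ := h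
    simp [shuffles, leftPart, rightPart]
  · rintro ⟨p, q⟩ h
    simp only [Finset.mem_sigma, Set.Finite.mem_toFinset, mem_splits, Finset.mem_product] at h ⊢
    obtain ⟨⟨rfl, rfl⟩, h₁, h₂⟩ := h
    exact ⟨append_mem_shuffles h₁ h₂, trivial⟩
  · rintro ⟨w, q⟩ h
    have hw : q.1 ++ q.2 = w := mem_splits.1 (Finset.mem_sigma.1 h).2
    exact congrArg (Sigma.mk · q) hw
  · rintro ⟨p, q⟩ h
    simp only [Finset.mem_sigma, Set.Finite.mem_toFinset, Finset.mem_product, shuffles,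
      Set.mem_ofPred_eq] at h
    simp [h]

theorem toPairs_mul (T U : Poly K A ⊗[K] Poly K B) (u : List A) (v : List B) :
    toPairs K A B (T * U) (u, v) = ∑ p ∈ splits u ×ˢ splits v,
      toPairs K A B T (p.1.1, p.2.1) * toPairs K A B U (p.1.2, p.2.2) := by
  induction T using TensorProduct.induction_on with
  | zero => simp
  | add T T' hT hT' =>
    simp only [add_mul, map_add, Pi.add_apply, hT, hT', Finset.sum_add_distrib]
  | tmul f g =>
    induction U using TensorProduct.induction_on with
    | zero => simp
    | add U U' hU hU' =>
      simp only [mul_add, map_add, Pi.add_apply, hU, hU', Finset.sum_add_distrib]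
    | tmul f' g' =>
      rw [Algebra.TensorProduct.tmul_mul_tmul, toPairs_tmul]
      change Poly.conv f.1 f'.1 u * Poly.conv g.1 g'.1 v = _
      rw [conv_eq_sum_splits, conv_eq_sum_splits, Finset.sum_mul_sum, ← Finset.sum_product']
      exact Finset.sum_congr rfl fun p _ => mul_mul_mul_comm _ _ _ _

theorem theta_consSeries {f : Poly K (A ⊕ B)} {P : A ⊕ B → Prop} {F : A ⊕ B → Poly K (A ⊕ B)}
    (hf : f.1 = consSeries P fun x => (F x).1) (u : List A) (v : List B) :
    theta K A B f (u, v) =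
      consSeries (P ∘ Sum.inl) (fun a u' => theta K A B (F (.inl a)) (u', v)) u +
      consSeries (P ∘ Sum.inr) (fun b v' => theta K A B (F (.inr b)) (u, v')) v := by
  classical
  simp only [theta_apply, hf]
  rw [← Finset.sum_filter_add_sum_filter_not _ fun w => ∃ a w', w = Sum.inl a :: w']
  congr 1
  · obtain - | ⟨a, u⟩ := u
    · refine Finset.sum_eq_zero fun w hw => ?_
      simp only [Finset.mem_filter, Set.Finite.mem_toFinset] at hw
      obtain ⟨hw, a, w, rfl⟩ := hw
      simp [inl_cons_mem_shuffles] at hw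
    · have himage : {w ∈ (shuffles_finite (a :: u) v).toFinset | ∃ a w', w = Sum.inl a :: w'} =
          (shuffles_finite u v).toFinset.image (Sum.inl a :: ·) := by
        ext (_ | ⟨_ | _, _⟩) <;> simp [inl_cons_mem_shuffles]
        grind
      rw [himage, Finset.sum_image (by simp)]
      simp [consSeries, Finset.sum_ite_irrel]
  · obtain - | ⟨b, v⟩ := v
    · refine Finset.sum_eq_zero fun w hw => ?_
      obtain - | ⟨_ | _, w⟩ := w <;> simp [inr_cons_mem_shuffles, consSeries] at hw ⊢
    · have himage : {w ∈ (shuffles_finite u (b :: v)).toFinset | ¬∃ a w', w = Sum.inl a :: w'} =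
          (shuffles_finite u v).toFinset.image (Sum.inr b :: ·) := by
        ext (_ | ⟨_ | _, _⟩) <;> simp [nil_mem_shuffles, inr_cons_mem_shuffles]
        grind
      rw [himage, Finset.sum_image (by simp)]
      simp [consSeries, Finset.sum_ite_irrel]

/-- The tensor `T` represents the image of the polynomial `f` by `θ`. -/
def Doubles (f : Poly K (A ⊕ B)) (T : Poly K A ⊗[K] Poly K B) : Prop :=
  theta K A B f = toPairs K A B T

namespace Doubles

variable {f g : Poly K (A ⊕ B)} {T U : Poly K A ⊗[K] Poly K B}

theorem mul (hf : Doubles f T) (hg : Doubles g U) : Doubles (f * g) (T * U) := by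
  funext ⟨u, v⟩
  rw [theta_mul, toPairs_mul, hf, hg]

theorem one : Doubles (1 : Poly K (A ⊕ B)) (1 : Poly K A ⊗[K] Poly K B) := by
  funext ⟨u, v⟩
  have one_eq_zero {α : Type u} {w : List α} (hw : w ≠ []) : (1 : Poly K α).1 w = 0 := by
    obtain - | ⟨x, w⟩ := w
    exacts [absurd rfl hw, rfl]
  rw [theta_apply, Algebra.TensorProduct.one_def, toPairs_tmul]
  by_cases hnil : [] ∈ shuffles u v
  · obtain ⟨rfl, rfl⟩ := nil_mem_shuffles.1 hnil
    rw [Finset.sum_eq_single_of_mem [] ((shuffles_finite _ _).mem_toFinset.2 hnil)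
      fun w _ hw => one_eq_zero hw]
    exact (mul_one _).symm
  · rw [Finset.sum_eq_zero fun w hw => one_eq_zero ?_]
    · rw [nil_mem_shuffles, not_and_or] at hnil
      obtain hu | hv := hnil
      · rw [one_eq_zero hu, zero_mul]
      · rw [one_eq_zero hv, mul_zero]
    · rintro rfl
      exact hnil ((shuffles_finite u v).mem_toFinset.1 hw)

theorem prod_ofFn {n : ℕ} {f : Fin n → Poly K (A ⊕ B)} {T : Fin n → Poly K A ⊗[K] Poly K B}
    (h : ∀ k, Doubles (f k) (T k)) : Doubles (List.ofFn f).prod (List.ofFn T).prod := by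
  induction n with
  | zero => simpa using one
  | succ n ih =>
    rw [List.ofFn_succ, List.ofFn_succ, List.prod_cons, List.prod_cons]
    exact (h 0).mul (ih fun k => h k.succ)

theorem of_consSeries {P : A ⊕ B → Prop} {F : A ⊕ B → Poly K (A ⊕ B)} {ι : Type*} {s : Finset ι}
    {M : ι → Poly K A} {X : ι → A → Poly K A} {Y : ι → Poly K B} {N : Poly K B} {Z : B → Poly K B}
    (hf : f.1 = consSeries P fun x => (F x).1)
    (hM : ∀ i, (M i).1 = consSeries (P ∘ Sum.inl) fun a => (X i a).1)
    (hN : N.1 = consSeries (P ∘ Sum.inr) fun b => (Z b).1)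
    (hX : ∀ a, P (.inl a) → Doubles (F (.inl a)) (∑ i ∈ s, X i a ⊗ₜ Y i))
    (hZ : ∀ b, Doubles (F (.inr b)) (1 ⊗ₜ Z b)) :
    Doubles f (∑ i ∈ s, M i ⊗ₜ Y i + 1 ⊗ₜ N) := by
  funext ⟨u, v⟩
  rw [theta_consSeries hf, map_add, map_sum, Pi.add_apply, Finset.sum_apply]
  simp only [toPairs_tmul, hM, hN]
  congr 1
  · obtain - | ⟨a, u⟩ := u
    · simp [consSeries]
    · by_cases ha : P (.inl a)
      · have hθ : theta K A B (F (.inl a)) = _ := hX a ha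
        simp [consSeries, ha, hθ, toPairs_tmul]
      · simp [consSeries, ha]
  · obtain - | ⟨b, v⟩ := v
    · simp [consSeries]
    · by_cases hb : P (.inr b)
      · have hθ : theta K A B (F (.inr b)) = _ := hZ b
        simp [consSeries, hb, hθ, toPairs_tmul]
      · simp [consSeries, hb]

end Doubles

end Theta

section TermFactorizations

open Operad

variable {S : Signature.{u}}

/-- A formal composite of terms: a term together with the terms to be grafted onto its leaves. It
is a `Composite` of the free operad, unfolded so that terms may be analysed by cases. -/
abbrev TermComposite (S : Signature.{u}) : Type u := (y : STerm S) × (Fin y.arity → STerm S)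

/-- The factorization `s(t₁, …, tₙ) = s(y₁, …, yₙ)[w₁ ⋯ wₙ]` obtained from factorizations
`tₖ = yₖ[wₖ]`. -/
def nodeComposite (s : S.carrier) (c : Fin (S.arity s) → TermComposite S) : TermComposite S :=
  ⟨.node s fun k => (c k).1, fun k : Fin (∑ i, (c i).1.arity) =>
    (c (finSigmaFinEquiv.symm k).1).2 (finSigmaFinEquiv.symm k).2⟩

theorem nodeComposite_snd (s : S.carrier) (c : Fin (S.arity s) → TermComposite S)
    (k : Fin (S.arity s)) (j : Fin (c k).1.arity) :
    (nodeComposite s c).2 (finSigmaFinEquiv (n := fun k => (c k).1.arity) ⟨k, j⟩) = (c k).2 j := by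
  change (c (finSigmaFinEquiv.symm
    (finSigmaFinEquiv (n := fun k => (c k).1.arity) ⟨k, j⟩)).1).2 _ = _
  rw [finSigmaFinEquiv.symm_apply_apply]

theorem ofFn_nodeComposite (s : S.carrier) (c : Fin (S.arity s) → TermComposite S) :
    List.ofFn (nodeComposite s c).2 = (List.ofFn fun k => List.ofFn (c k).2).flatten :=
  (ofFn_eq_flatten (n := fun k => (c k).1.arity) (nodeComposite s c).2).trans <|
    congrArg (fun l => (List.ofFn l).flatten) <| funext fun k =>
      congrArg List.ofFn (funext fun j => nodeComposite_snd s c k j)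

theorem graft_nodeComposite (s : S.carrier) (c : Fin (S.arity s) → TermComposite S) :
    (nodeComposite s c).1.graft (nodeComposite s c).2 =
      .node s fun k => (c k).1.graft (c k).2 :=
  congrArg (STerm.node s) <| funext fun k => congrArg (STerm.graft (c k).1) <|
    funext fun j => nodeComposite_snd s c k j

theorem nodeComposite_curry (s : S.carrier) (y : Fin (S.arity s) → STerm S)
    (w : Fin (STerm.node s y).arity → STerm S) :
    nodeComposite s (fun k => ⟨y k, fun j => w (finSigmaFinEquiv ⟨k, j⟩)⟩) = ⟨.node s y, w⟩ :=
  congrArg (Sigma.mk (STerm.node s y)) <| funext fun k =>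
    congrArg w (finSigmaFinEquiv.apply_symm_apply k)

theorem nodeComposite_injective (s : S.carrier) :
    Function.Injective (nodeComposite (S := S) s) := by
  suffices key : ∀ (y y' : Fin (S.arity s) → STerm S) (w : ∀ k, Fin (y k).arity → STerm S)
      (w' : ∀ k, Fin (y' k).arity → STerm S),
      nodeComposite s (fun k => ⟨y k, w k⟩) = nodeComposite s (fun k => ⟨y' k, w' k⟩) →
      ∀ k, (⟨y k, w k⟩ : TermComposite S) = ⟨y' k, w' k⟩ from
    fun c c' h => funext (key (fun k => (c k).1) (fun k => (c' k).1) (fun k => (c k).2)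
      (fun k => (c' k).2) h)
  intro y y' w w' h k
  obtain ⟨hy, hw⟩ := Sigma.mk.inj h
  obtain rfl : y = y' := by injection hy
  refine congrArg (Sigma.mk (y k)) (funext fun j => ?_)
  exact (nodeComposite_snd s (fun k => ⟨y k, w k⟩) k j).symm.trans <|
    (congrFun (eq_of_heq hw) _).trans (nodeComposite_snd s (fun k => ⟨y k, w' k⟩) k j)

theorem composite_leaf (w : Fin (STerm.leaf : STerm S).arity → STerm S) :
    (⟨.leaf, w⟩ : TermComposite S) = ⟨.leaf, fun _ => STerm.leaf.graft w⟩ :=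
  congrArg (Sigma.mk STerm.leaf) <| funext fun k => congrArg w (Subsingleton.elim (α := Fin 1) k 0)

theorem graft_eq_leaf_iff (p : TermComposite S) :
    p.1.graft p.2 = .leaf ↔ p = ⟨.leaf, fun _ => .leaf⟩ := by
  refine ⟨fun hp => ?_, by rintro rfl; rfl⟩
  obtain ⟨_ | ⟨s, y⟩, w⟩ := p
  · rw [composite_leaf, hp]
  · cases hp

theorem graft_eq_node_iff (s : S.carrier) (t : Fin (S.arity s) → STerm S) (p : TermComposite S) :
    p.1.graft p.2 = .node s t ↔ p = ⟨.leaf, fun _ => .node s t⟩ ∨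
      ∃ c, (∀ k, (c k).1.graft (c k).2 = t k) ∧ nodeComposite s c = p := by
  constructor
  · intro hp
    obtain ⟨_ | ⟨s', y⟩, w⟩ := p
    · left
      rw [composite_leaf, hp]
    · right
      obtain ⟨rfl, ht⟩ := STerm.node.inj hp
      exact ⟨_, congrFun (eq_of_heq ht), nodeComposite_curry s' y w⟩
  · rintro (rfl | ⟨c, hc, rfl⟩)
    · rfl
    · rw [graft_nodeComposite, funext hc]

theorem freeOperad_finitelyFactorizable (S : Signature.{u}) :
    (freeOperad S).FinitelyFactorizable := by
  intro t
  change {p : TermComposite S | p.1.graft p.2 = t}.Finite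
  induction t with
  | leaf => simp only [graft_eq_leaf_iff, Set.ofPred_eq_eq_singleton, Set.finite_singleton]
  | node s t ih =>
    simp only [graft_eq_node_iff]
    exact (Set.finite_singleton _).union ((Set.Finite.pi' ih).image (nodeComposite s))

/-- The factorizations of a term. -/
def termFactorizations (t : STerm S) : Finset (TermComposite S) :=
  factorizations (freeOperad_finitelyFactorizable S) t

@[simp]
theorem mem_termFactorizations {t : STerm S} {p : TermComposite S} :
    p ∈ termFactorizations t ↔ p.1.graft p.2 = t :=
  mem_factorizations (hO := freeOperad_finitelyFactorizable S)

theorem termFactorizations_leaf :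
    termFactorizations (.leaf : STerm S) = {⟨.leaf, fun _ => .leaf⟩} := by
  ext p
  rw [mem_termFactorizations, graft_eq_leaf_iff, Finset.mem_singleton]

theorem sum_termFactorizations_node {M : Type*} [AddCommMonoid M] (s : S.carrier)
    (t : Fin (S.arity s) → STerm S) (F : TermComposite S → M) :
    ∑ p ∈ termFactorizations (.node s t), F p =
      ∑ c ∈ Fintype.piFinset fun k => termFactorizations (t k), F (nodeComposite s c) +
        F ⟨.leaf, fun _ => .node s t⟩ := by
  classical
  have hnode : termFactorizations (.node s t) = insert ⟨.leaf, fun _ => .node s t⟩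
      ((Fintype.piFinset fun k => termFactorizations (t k)).image (nodeComposite s)) := by
    ext p
    simp only [mem_termFactorizations, graft_eq_node_iff, Finset.mem_insert, Finset.mem_image,
      Fintype.mem_piFinset]
  rw [hnode, Finset.sum_insert, Finset.sum_image (nodeComposite_injective s).injOn, add_comm]
  intro hmem
  obtain ⟨c, -, hc⟩ := Finset.mem_image.1 hmem
  cases congrArg Sigma.fst hc

theorem STerm.degree_eq_zero_iff (t : STerm S) : t.degree = 0 ↔ t = .leaf := by
  cases t <;> simp [STerm.degree]

theorem isGrading_degree (S : Signature.{u}) : (freeOperad S).IsGrading STerm.degree where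
  eq_zero_iff := STerm.degree_eq_zero_iff
  comp t w := by
    change (STerm.graft t w).degree = STerm.degree t + ∑ i : Fin t.arity, (w i).degree
    induction t with
    | leaf =>
      rw [STerm.degree, zero_add]
      exact (Fin.sum_univ_one fun i : Fin 1 => (w i).degree).symm
    | node s t ih =>
      change 1 + ∑ i, ((t i).graft _).degree = 1 + ∑ i, (t i).degree +
        ∑ k : Fin (∑ i, (t i).arity), (w k).degree
      rw [add_assoc, ← finSigmaFinEquiv.sum_comp, Fintype.sum_sigma, ← Finset.sum_add_distrib]
      exact congrArg _ (Finset.sum_congr rfl fun i _ => ih i _)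

end TermFactorizations

theorem Doubles.prod_ofFn_one_tmul {K : Type v} [Field K] {A B : Type u} {n : ℕ}
    {f : Fin n → Poly K (A ⊕ B)} {g : Fin n → Poly K B} (h : ∀ k, Doubles (f k) (1 ⊗ₜ g k)) :
    Doubles (List.ofFn f).prod (1 ⊗ₜ (List.ofFn g).prod) := by
  simpa only [prod_ofFn_tmul, List.ofFn_const, List.prod_replicate, one_pow] using prod_ofFn h

section TermDoubling

open Operad ForestAlphabet

variable (K : Type v) [Field K] {S : Signature.{u}} (A B : ForestAlphabet S.carrier)

/-- The disjoint sum of two forest-like alphabets. -/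
abbrev sumAlphabet : ForestAlphabet S.carrier := (sumRel S.carrier).sum A B

variable {A B}

theorem doubles_termSum_of_forall_inr {P : A.carrier ⊕ B.carrier → Prop}
    (hP : ∀ a, ¬P (.inl a)) (t : STerm S) :
    Doubles (termSum K (sumAlphabet A B) P t) (1 ⊗ₜ termSum K B (P ∘ Sum.inr) t) := by
  induction t generalizing P with
  | leaf =>
    rw [termSum_leaf, termSum_leaf]
    exact Doubles.one
  | node s t ih =>
    have hnode := Doubles.of_consSeries (ι := Empty) (s := ∅) (M := nofun) (X := nofun)
      (Y := nofun) (termSum_node K (sumAlphabet A B) P s t) nofun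
      (termSum_node K B (P ∘ Sum.inr) s t) (fun a ha => absurd ha.1 (hP a)) fun b =>
        .prod_ofFn_one_tmul fun k =>
          ih k (P := IsEdge (sumAlphabet A B) k.val.succPNat (.inr b)) fun _ => not_false
    simpa only [Finset.sum_empty, zero_add] using hnode

variable (A B) in
/-- The tensor contributed to the coproduct of a term by one of its factorizations. -/
def compositeTensor (P : A.carrier → Prop) (p : TermComposite S) :
    Poly K A.carrier ⊗[K] Poly K B.carrier :=
  termSum K A P p.1 ⊗ₜ (List.ofFn fun k => termSum K B (IsRoot B) (p.2 k)).prod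

theorem sum_prod_compositeTensor {n : ℕ} (P : Fin n → A.carrier → Prop)
    (s : Fin n → Finset (TermComposite S)) :
    (List.ofFn fun k => ∑ p ∈ s k, compositeTensor K A B (P k) p).prod =
      ∑ c ∈ Fintype.piFinset s, (List.ofFn fun k => termSum K A (P k) (c k).1).prod ⊗ₜ
        ((List.ofFn fun k => List.ofFn (c k).2).flatten.map (termSum K B (IsRoot B))).prod := by
  simp only [prod_ofFn_sum, compositeTensor, prod_ofFn_tmul, List.map_flatten, List.prod_flatten,
    List.map_ofFn, Function.comp_def]

theorem doubles_termSum {P : A.carrier ⊕ B.carrier → Prop} (hP : P ∘ Sum.inr = IsRoot B)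
    (t : STerm S) :
    Doubles (termSum K (sumAlphabet A B) P t)
      (∑ p ∈ termFactorizations t, compositeTensor K A B (P ∘ Sum.inl) p) := by
  induction t generalizing P with
  | leaf =>
    rw [termFactorizations_leaf, Finset.sum_singleton, compositeTensor]
    simp only [termSum_leaf, List.ofFn_const, List.prod_replicate, one_pow]
    exact Doubles.one
  | node s t ih =>
    have htrivial : compositeTensor K A B (P ∘ Sum.inl) ⟨.leaf, fun _ => .node s t⟩ =
        1 ⊗ₜ termSum K B (P ∘ Sum.inr) (.node s t) := by
      rw [compositeTensor, termSum_leaf, hP]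
      exact congrArg _ (mul_one _)
    have hargs (c : Fin (S.arity s) → TermComposite S) :
        (List.ofFn fun k => termSum K B (IsRoot B) ((nodeComposite s c).2 k)).prod =
          ((List.ofFn fun k => List.ofFn (c k).2).flatten.map (termSum K B (IsRoot B))).prod := by
      rw [← ofFn_nodeComposite, List.map_ofFn]
      rfl
    rw [sum_termFactorizations_node, htrivial]
    simp only [compositeTensor, hargs]
    refine .of_consSeries (termSum_node K (sumAlphabet A B) P s t)
      (fun c => termSum_node K A (P ∘ Sum.inl) s fun k => (c k).1)
      (termSum_node K B (P ∘ Sum.inr) s t) (fun a _ => ?_) fun b =>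
        .prod_ofFn_one_tmul fun k => doubles_termSum_of_forall_inr K
          (P := IsEdge (sumAlphabet A B) k.val.succPNat (.inr b)) (fun _ => not_false) (t k)
    rw [← sum_prod_compositeTensor]
    exact .prod_ofFn fun k =>
      ih k (P := IsEdge (sumAlphabet A B) k.val.succPNat (.inl a)) rfl

theorem doubles_realizeHom_letter (t : (freeOperad S).carrier) :
    Doubles (realizeHom K (sumAlphabet A B) (letter K t))
      (Algebra.TensorProduct.map (realizeHom K A) (realizeHom K B)
        (comul K (freeOperad S) (letter K t))) := by
  have hmap : Algebra.TensorProduct.map (realizeHom K A) (realizeHom K B)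
      (comul K (freeOperad S) (letter K t)) =
      ∑ p ∈ termFactorizations t, compositeTensor K A B (IsRoot A) p := by
    rw [comul_letter K (freeOperad_finitelyFactorizable S) (isGrading_degree S), map_sum]
    refine Finset.sum_congr rfl fun p _ => ?_
    rw [Algebra.TensorProduct.map_tmul, map_prod_ofFn]
    exact congrArg₂ _ (realizeHom_letter K A p.1) (congrArg List.prod
      (congrArg List.ofFn (funext fun k => realizeHom_letter K B (p.2 k))))
  refine Eq.trans (congrArg (theta K A.carrier B.carrier) (realizeHom_letter K _ t)) ?_
  rw [hmap]
  exact doubles_termSum K rfl t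

variable {K}

theorem doubles_realizeHom (x : NatAlg K (freeOperad S)) :
    Doubles (realizeHom K (sumAlphabet A B) x)
      (Algebra.TensorProduct.map (realizeHom K A) (realizeHom K B)
        (comul K (freeOperad S) x)) := by
  suffices hlin : theta K A.carrier B.carrier ∘ₗ (realizeHom K (sumAlphabet A B)).toLinearMap =
      toPairs K A.carrier B.carrier ∘ₗ ((Algebra.TensorProduct.map (realizeHom K A)
        (realizeHom K B)).comp (comul K (freeOperad S))).toLinearMap from
    LinearMap.congr_fun hlin x
  refine natAlg_linearMap_ext fun w => ?_
  change Doubles (realizeHom K (sumAlphabet A B) (elem K w)) (Algebra.TensorProduct.map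
    (realizeHom K A) (realizeHom K B) (comul K (freeOperad S) (elem K w)))
  induction w using FreeMonoid.inductionOn' with
  | one => simpa only [elem_one, map_one] using Doubles.one
  | of_mul t w ih =>
    rw [elem_mul, ← letter_nonUnit, map_mul, map_mul, map_mul]
    exact (doubles_realizeHom_letter K t.1).mul ih

end TermDoubling

namespace Operad

variable {O : Operad.{u}}

namespace Congruence

variable (c : O.Congruence) {deg : O.carrier → ℕ}

theorem isGrading_quotient (h : O.IsGrading deg)
    (hdeg : ∀ x x', c.setoid x x' → deg x = deg x') :
    c.quotient.IsGrading (Quotient.lift deg hdeg) where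
  eq_zero_iff x := by
    obtain ⟨x, rfl⟩ : ∃ x', c.proj x' = x := ⟨_, c.proj_rep x⟩
    change deg x = 0 ↔ c.proj x = c.proj O.unit
    rw [h.eq_zero_iff]
    refine ⟨congrArg c.proj, fun hx => (h.eq_zero_iff x).1 ?_⟩
    rw [hdeg _ _ (c.proj_eq_iff.1 hx), (h.eq_zero_iff _).2 rfl]
  comp x y := by
    obtain ⟨x, y, rfl, hy⟩ := c.exists_proj x y
    obtain rfl := funext hy
    exact (congrArg (Quotient.lift deg hdeg) (c.quotComp_proj x y)).trans (h.comp x y)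

variable {c}

theorem eq_unit_of_proj_eq (h : O.IsGrading deg)
    (hdeg : ∀ x x', c.setoid x x' → deg x = deg x') {x : O.carrier}
    (hx : c.proj x = c.quotient.unit) : x = O.unit := by
  rw [← h.eq_zero_iff, hdeg _ _ (c.proj_eq_iff.1 hx), h.eq_zero_iff]

variable (c) in
/-- The projection of a formal composite. -/
def projComposite (p : O.Composite) : c.quotient.Composite :=
  ⟨c.proj p.1, fun i => c.proj (p.2 i)⟩

theorem comp_projComposite (p : O.Composite) :
    c.quotient.comp (c.projComposite p).1 (c.projComposite p).2 = c.proj (O.comp p.1 p.2) :=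
  c.quotComp_proj p.1 p.2

theorem projComposite_surjective : Function.Surjective c.projComposite := by
  rintro ⟨x, y⟩
  obtain ⟨x, y, rfl, hy⟩ := c.exists_proj x y
  obtain rfl := funext hy
  exact ⟨⟨x, y⟩, rfl⟩

variable (hfin : ∀ x, {x' | c.setoid x' x}.Finite)

/-- The elements of an equivalence class, when the classes are finite. -/
def fiber (x : c.quotient.carrier) : Finset O.carrier :=
  (hfin (c.rep x)).toFinset

theorem mem_fiber {x : c.quotient.carrier} {t : O.carrier} : t ∈ fiber hfin x ↔ c.proj t = x :=
  (Set.Finite.mem_toFinset _).trans (c.proj_eq_iff.symm.trans (Eq.congr_right (c.proj_rep x)))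

theorem fiber_unit (h : O.IsGrading deg) (hdeg : ∀ x x', c.setoid x x' → deg x = deg x') :
    fiber hfin c.quotient.unit = {O.unit} := by
  ext t
  rw [mem_fiber, Finset.mem_singleton]
  exact ⟨eq_unit_of_proj_eq h hdeg, by rintro rfl; rfl⟩

variable (hO : O.FinitelyFactorizable)

open scoped Classical in
/-- The formal composites that project onto a given formal composite. -/
def compositeFiber (q : c.quotient.Composite) : Finset O.Composite :=
  ((fiber hfin (c.quotient.comp q.1 q.2)).biUnion (factorizations hO)).filter
    (c.projComposite · = q)

theorem mem_compositeFiber {q : c.quotient.Composite} {p : O.Composite} :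
    p ∈ compositeFiber hfin hO q ↔ c.projComposite p = q := by
  simp only [compositeFiber, Finset.mem_filter, Finset.mem_biUnion, mem_fiber, mem_factorizations,
    and_iff_right_iff_imp]
  rintro rfl
  exact ⟨_, (comp_projComposite p).symm, rfl⟩

include hO hfin in
theorem finitelyFactorizable_quotient : c.quotient.FinitelyFactorizable := by
  classical
  intro x
  refine (((fiber hfin x).biUnion (factorizations hO)).image
    c.projComposite).finite_toSet.subset fun q hq => ?_
  obtain ⟨p, rfl⟩ := projComposite_surjective q
  rw [Finset.mem_coe, Finset.mem_image]
  exact ⟨p, Finset.mem_biUnion.2 ⟨_, (mem_fiber hfin).2 ((comp_projComposite p).symm.trans hq),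
    mem_factorizations.2 rfl⟩, rfl⟩

theorem sum_fiber_factorizations {M : Type*} [AddCommMonoid M] (F : O.Composite → M)
    (x : c.quotient.carrier) :
    ∑ t ∈ fiber hfin x, ∑ p ∈ factorizations hO t, F p =
      ∑ q ∈ factorizations (finitelyFactorizable_quotient hfin hO) x,
        ∑ p ∈ compositeFiber hfin hO q, F p := by
  rw [Finset.sum_sigma', Finset.sum_sigma']
  refine Finset.sum_nbij' (fun x => ⟨c.projComposite x.2, x.2⟩)
    (fun x => ⟨O.comp x.2.1 x.2.2, x.2⟩) ?_ ?_ ?_ ?_ fun _ _ => rfl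
  all_goals
    rintro ⟨_, p⟩ hp
    simp only [Finset.mem_sigma, mem_fiber, mem_factorizations, mem_compositeFiber] at hp ⊢
  · exact ⟨by rw [comp_projComposite, hp.2, hp.1], trivial⟩
  · exact ⟨by rw [← comp_projComposite, hp.2, hp.1], trivial⟩
  · rw [hp.2]
  · rw [hp.2]

end Congruence

end Operad

namespace Operad.Congruence

variable {O : Operad.{u}} {c : O.Congruence} {deg : O.carrier → ℕ}

section WordFiber

variable (hfin : ∀ x, {x' | c.setoid x' x}.Finite)

open scoped Classical in
/-- The words that project letter by letter onto a given word. -/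
def wordFiber (w : c.quotient.RWord) : Finset O.RWord :=
  (Fintype.piFinset fun i => fiber hfin (w.word.get i)).image fun y => O.rd (List.ofFn y)

theorem word_rd_ofFn_of_mem_fiber {w : c.quotient.RWord} {y : Fin w.word.length → O.carrier}
    (hy : y ∈ Fintype.piFinset fun i => fiber hfin (w.word.get i)) :
    (O.rd (List.ofFn y)).word = List.ofFn y := by
  refine word_rd fun hmem => unit_notMem_word w ?_
  obtain ⟨i, hi⟩ := List.mem_ofFn.1 hmem
  have hproj : c.proj (y i) = w.word.get i := (mem_fiber hfin).1 (Fintype.mem_piFinset.1 hy i)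
  have hunit : c.quotient.unit = w.word.get i := (congrArg c.proj hi).symm.trans hproj
  exact hunit ▸ List.get_mem _ _

theorem mem_wordFiber {w : c.quotient.RWord} {f : O.RWord} :
    f ∈ wordFiber hfin w ↔ f.word.map c.proj = w.word := by
  classical
  refine Finset.mem_image.trans ⟨?_, fun h => ?_⟩
  · rintro ⟨y, hy, rfl⟩
    rw [word_rd_ofFn_of_mem_fiber hfin hy, List.map_ofFn]
    refine Eq.trans (congrArg List.ofFn (funext fun i => ?_)) (List.ofFn_get w.word)
    exact (mem_fiber hfin).1 (Fintype.mem_piFinset.1 hy i)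
  · have hlen : w.word.length = f.word.length :=
      (congrArg List.length h).symm.trans (List.length_map _)
    refine ⟨fun i => f.word.get (i.cast hlen), Fintype.mem_piFinset.2 fun i => ?_, ?_⟩
    · rw [mem_fiber, List.get_of_eq h.symm]
      exact (List.getElem_map c.proj).symm
    · exact (congrArg O.rd ((List.ofFn_congr hlen _).trans (List.ofFn_get f.word))).trans
        (rd_word f)

open scoped Classical in
theorem wordFiber_nonempty (w : c.quotient.RWord) : (wordFiber hfin w).Nonempty :=
  (Fintype.piFinset_nonempty.2 fun i =>
    ⟨c.rep (w.word.get i), (mem_fiber hfin).2 (c.proj_rep _)⟩).image _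

theorem injOn_rd_ofFn (w : c.quotient.RWord) : Set.InjOn (fun y => O.rd (List.ofFn y))
    (Fintype.piFinset fun i => fiber hfin (w.word.get i) : Set (Fin w.word.length → O.carrier)) :=
  fun y hy y' hy' h => List.ofFn_injective <| calc
    List.ofFn y = (O.rd (List.ofFn y)).word := (word_rd_ofFn_of_mem_fiber hfin hy).symm
    _ = (O.rd (List.ofFn y')).word := congrArg RWord.word h
    _ = List.ofFn y' := word_rd_ofFn_of_mem_fiber hfin hy'

end WordFiber

section FiberHom

variable (K : Type v) [Field K] (hfin : ∀ x, {x' | c.setoid x' x}.Finite)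

/-- The algebra morphism `N(O/≡) → N(O)` sending a generator to the sum of the generators of its
equivalence class. -/
def fiberHom : NatAlg K c.quotient →ₐ[K] NatAlg K O :=
  algLift K fun x => ∑ t ∈ fiber hfin x, letter K t

theorem fiberHom_letter (h : O.IsGrading deg) (hdeg : ∀ x x', c.setoid x x' → deg x = deg x')
    (x : c.quotient.carrier) : fiberHom K hfin (letter K x) = ∑ t ∈ fiber hfin x, letter K t :=
  algLift_letter (by rw [fiber_unit hfin h hdeg, Finset.sum_singleton, letter_unit]) x

theorem fiberHom_elem (h : O.IsGrading deg) (hdeg : ∀ x x', c.setoid x x' → deg x = deg x')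
    (w : c.quotient.RWord) :
    fiberHom K hfin (elem K w) = ∑ f ∈ wordFiber hfin w, elem K f := by
  classical
  rw [wordFiber, Finset.sum_image (injOn_rd_ofFn hfin w)]
  simp only [elem_rd_ofFn]
  rw [← prod_ofFn_sum, elem_eq_prod, map_list_prod, List.map_map]
  conv_lhs => rw [← List.ofFn_get w.word, List.map_ofFn]
  simp only [Function.comp_def, fiberHom_letter K hfin h hdeg]

theorem fiberHom_injective (h : O.IsGrading deg)
    (hdeg : ∀ x x', c.setoid x x' → deg x = deg x') :
    Function.Injective (fiberHom K hfin) := by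
  classical
  choose f hf using wordFiber_nonempty hfin
  let coeffHom (w : c.quotient.RWord) : NatAlg K O →ₗ[K] K :=
    Finsupp.lapply (f w) ∘ₗ (MonoidAlgebra.coeffLinearEquiv K).toLinearMap
  have hcoeff (w w' : c.quotient.RWord) :
      coeffHom w (fiberHom K hfin (elem K w')) = if f w ∈ wordFiber hfin w' then 1 else 0 := by
    rw [fiberHom_elem K hfin h hdeg, map_sum]
    exact (Finset.sum_congr rfl fun g _ => Finsupp.single_apply).trans
      (Finset.sum_ite_eq' _ (f w) fun _ => 1)
  refine natAlg_injective_of_dual (F := (fiberHom K hfin).toLinearMap) coeffHom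
    (fun w => (hcoeff w w).trans (if_pos (hf w))) fun w w' hne =>
      (hcoeff w w').trans (if_neg fun hmem => hne (word_injective ?_))
  exact ((mem_wordFiber hfin).1 hmem).symm.trans ((mem_wordFiber hfin).1 (hf w))

theorem sum_compositeFiber (hO : O.FinitelyFactorizable) (q : c.quotient.Composite) :
    ∑ p ∈ compositeFiber hfin hO q,
        letter K p.1 ⊗ₜ[K] (List.ofFn fun i => letter K (p.2 i)).prod =
      (∑ y ∈ fiber hfin q.1, letter K y) ⊗ₜ
        (List.ofFn fun i => ∑ z ∈ fiber hfin (q.2 i), letter K z).prod := by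
  classical
  rw [TensorProduct.sum_tmul]
  have hsigma : compositeFiber hfin hO q = (fiber hfin q.1).sigma fun y =>
      (compositeFiber hfin hO q).preimage (Sigma.mk y) sigma_mk_injective.injOn := by
    ext ⟨y, z⟩
    rw [Finset.mem_sigma, Finset.mem_preimage, mem_fiber, mem_compositeFiber]
    exact ⟨fun hq => ⟨congrArg Sigma.fst hq, hq⟩, And.right⟩
  rw [hsigma, Finset.sum_sigma]
  refine Finset.sum_congr rfl fun y hy => ?_
  obtain ⟨x, x'⟩ := q
  obtain rfl : c.proj y = x := (mem_fiber hfin).1 hy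
  refine (TensorProduct.tmul_sum (letter K y) _ fun z : Fin (O.arity y) → O.carrier =>
    (List.ofFn fun i => letter K (z i)).prod).symm.trans (congrArg _ ?_)
  refine (Finset.sum_congr ?_ fun _ _ => rfl).trans (prod_ofFn_sum _ _).symm
  ext z
  refine (Finset.mem_preimage.trans (mem_compositeFiber hfin hO)).trans
    (Iff.trans ⟨fun hq i => ?_, fun hz => ?_⟩ Fintype.mem_piFinset.symm)
  · exact (mem_fiber hfin).2 (congrFun (eq_of_heq (Sigma.mk.inj hq).2) i)
  · exact congrArg (Sigma.mk (c.proj y)) (funext fun i => (mem_fiber hfin).1 (hz i))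

theorem comul_fiberHom (h : O.IsGrading deg) (hdeg : ∀ x x', c.setoid x x' → deg x = deg x')
    (hO : O.FinitelyFactorizable) (x : NatAlg K c.quotient) :
    comul K O (fiberHom K hfin x) =
      Algebra.TensorProduct.map (fiberHom K hfin) (fiberHom K hfin) (comul K c.quotient x) := by
  have hhom : (comul K O).comp (fiberHom K hfin) =
      (Algebra.TensorProduct.map (fiberHom K hfin) (fiberHom K hfin)).comp
        (comul K c.quotient) := by
    refine natAlg_algHom_ext fun x => ?_
    simp only [AlgHom.comp_apply, fiberHom_letter K hfin h hdeg, map_sum, comul_letter K hO h,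
      comul_letter K (finitelyFactorizable_quotient hfin hO) (isGrading_quotient c h hdeg),
      Algebra.TensorProduct.map_tmul, map_prod_ofFn, sum_fiber_factorizations,
      sum_compositeFiber]
  exact DFunLike.congr_fun hhom x

end FiberHom

end Operad.Congruence

theorem filter_flatten_ofFn {α : Type*} {n : ℕ} (l : Fin n → List α) (q : α → Bool) (k : Fin n)
    (hk : ∀ b ∈ l k, q b) (hne : ∀ k', k' ≠ k → ∀ b ∈ l k', ¬ q b) :
    (List.ofFn l).flatten.filter q = l k := by
  induction n with
  | zero => exact k.elim0
  | succ n ih =>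
    rw [List.ofFn_succ, List.flatten_cons, List.filter_append]
    cases k using Fin.cases with
    | zero =>
      rw [List.filter_eq_self.2 hk, List.filter_eq_nil_iff.2, List.append_nil]
      intro b hb
      obtain ⟨_, hl, hb⟩ := List.mem_flatten.1 hb
      obtain ⟨i, rfl⟩ := List.mem_ofFn.1 hl
      exact hne i.succ (Fin.succ_ne_zero i) b hb
    | succ k =>
      rw [List.filter_eq_nil_iff.2 (hne 0 (Fin.succ_ne_zero k).symm), List.nil_append]
      exact ih (fun k => l k.succ) k hk fun k' h => hne k'.succ (by simpa using h)

theorem not_append_singleton_isPrefix {p q : List ℕ} {i j : ℕ} (h : p ++ [i] <+: q)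
    (hij : i ≠ j) : ¬ p ++ [j] <+: q := fun h' => by
  have heq := (List.prefix_of_prefix_length_le h h' (by simp)).eq_of_length (by simp)
  exact hij (by simpa using heq)

section Positions

variable {S : Signature.{u}}

local notation "A_p" => ForestAlphabet.positions S.carrier

/-- The sequence of child indices read along a position. The zeros of a position carry no
information: they only make the relations of the alphabet of positions compatible with sums. -/
def path (a : (ForestAlphabet.positions S.carrier).carrier) : List ℕ :=
  (Prod.snd (α := S.carrier) a).filter (· ≠ 0)

theorem path_of_isRoot {a : (A_p).carrier} (ha : ForestAlphabet.IsRoot A_p a) : path a = [] := by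
  obtain ⟨l, hl⟩ := ha
  exact (congrArg (List.filter (· ≠ 0)) hl).trans (by
    rw [List.filter_replicate_of_neg (by simp)])

theorem path_of_isEdge {j : ℕ+} {a b : (A_p).carrier} (h : ForestAlphabet.IsEdge A_p j a b) :
    path b = path a ++ [(j : ℕ)] := by
  obtain ⟨l, hl⟩ := h
  refine (congrArg (List.filter (· ≠ 0)) hl).trans ?_
  rw [List.filter_append, List.filter_append, List.filter_replicate_of_neg (by simp),
    List.append_nil]
  exact congrArg (path a ++ ·) (List.filter_eq_self.2 (by simp))

namespace STerm

theorem isPrefix_path_of_mem_language {t : STerm S} {P : (A_p).carrier → Prop} {p : List ℕ}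
    (hP : ∀ a, P a → path a = p) {w : List (A_p).carrier} (hw : w ∈ t.language A_p P) :
    ∀ b ∈ w, p <+: path b := by
  induction t generalizing P w p with
  | leaf =>
    rw [(Language.mem_one _).1 hw]
    simp
  | node s t ih =>
    obtain ⟨a, v, rfl, ha, -, hv⟩ := hw
    obtain ⟨l, hl, rfl⟩ := mem_prod_ofFn_language.1 hv
    intro b hb
    obtain rfl | hb := List.mem_cons.1 hb
    · rw [hP _ ha]
    · obtain ⟨_, hlk, hb⟩ := List.mem_flatten.1 hb
      obtain ⟨k, rfl⟩ := List.mem_ofFn.1 hlk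
      refine (List.prefix_append p [(k.val.succPNat : ℕ)]).trans
        (ih k (fun a' ha' => ?_) (hl k) b hb)
      rw [path_of_isEdge ha', hP _ ha]

/-- Each child is recovered from the word of its parent as the letters whose path goes through
it. -/
theorem filter_flatten_of_mem_language {n : ℕ} {t : Fin n → STerm S} {a : (A_p).carrier}
    {l : Fin n → List (A_p).carrier}
    (hl : ∀ k, l k ∈ (t k).language A_p (ForestAlphabet.IsEdge A_p k.val.succPNat a))
    (k : Fin n) :
    (List.ofFn l).flatten.filter (fun b => path a ++ [k.val + 1] <+: path b) = l k := by
  have hpre : ∀ k, ∀ b ∈ l k, path a ++ [k.val + 1] <+: path b := fun k =>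
    isPrefix_path_of_mem_language (fun _ => path_of_isEdge) (hl k)
  refine filter_flatten_ofFn _ _ k (fun b hb => by simpa using hpre k b hb) fun k' hk b hb => ?_
  simpa using not_append_singleton_isPrefix (hpre k' b hb) fun h => hk (Fin.ext (by omega))

theorem eq_of_mem_language {t t' : STerm S} {P P' : (A_p).carrier → Prop}
    {w : List (A_p).carrier} (hw : w ∈ t.language A_p P) (hw' : w ∈ t'.language A_p P') :
    t = t' := by
  induction t generalizing t' P P' w with
  | leaf =>
    cases t' with
    | leaf => rfl
    | node s' t' =>
      obtain ⟨a, v, rfl, -⟩ := hw'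
      exact absurd ((Language.mem_one _).1 hw) (List.cons_ne_nil _ _)
  | node s t ih =>
    obtain ⟨a, v, rfl, -, hs, hv⟩ := hw
    cases t' with
    | leaf => exact absurd ((Language.mem_one _).1 hw') (List.cons_ne_nil _ _)
    | node s' t' =>
      obtain ⟨a', v', heq, -, hs', hv'⟩ := hw'
      obtain ⟨rfl, rfl⟩ := List.cons.inj heq
      obtain rfl : s = s' := Eq.trans (Eq.symm hs) hs'
      obtain ⟨l, hl, rfl⟩ := mem_prod_ofFn_language.1 hv
      obtain ⟨l', hl', hflat⟩ := mem_prod_ofFn_language.1 hv'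
      refine congrArg (node s) (funext fun k => ?_)
      have hk : l k = l' k := by
        rw [← filter_flatten_of_mem_language hl k, ← hflat, filter_flatten_of_mem_language hl' k]
      exact ih k (hl k) (hk ▸ hl' k)

theorem exists_cons_of_mem_language {t : STerm S} (ht : t ≠ leaf) {w : List (A_p).carrier}
    (hw : w ∈ t.language A_p (ForestAlphabet.IsRoot A_p)) :
    ∃ a v, w = a :: v ∧ path a = [] ∧ ∀ b ∈ v, path b ≠ [] := by
  cases t with
  | leaf => exact absurd rfl ht
  | node s t =>
    obtain ⟨a, v, rfl, ha, -, hv⟩ := hw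
    obtain ⟨l, hl, rfl⟩ := mem_prod_ofFn_language.1 hv
    refine ⟨a, _, rfl, path_of_isRoot ha, fun b hb hnil => ?_⟩
    obtain ⟨_, hlk, hb⟩ := List.mem_flatten.1 hb
    obtain ⟨k, rfl⟩ := List.mem_ofFn.1 hlk
    have hpre := isPrefix_path_of_mem_language (fun _ => path_of_isEdge) (hl k) b hb
    rw [hnil] at hpre
    simp at hpre

theorem language_nonempty (t : STerm S) {P : (A_p).carrier → Prop} {u : List ℕ}
    (hP : ∀ s : S.carrier, P (s, u)) : (t.language A_p P).Nonempty := by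
  induction t generalizing P u with
  | leaf => exact ⟨[], rfl⟩
  | node s t ih =>
    choose l hl using fun k : Fin (S.arity s) =>
      ih k (P := ForestAlphabet.IsEdge A_p k.val.succPNat (s, u)) (u := u ++ [k.val + 1])
        fun _ => ⟨0, (List.append_nil _).symm⟩
    exact ⟨_, (s, u), _, rfl, hP s, rfl, mem_prod_ofFn_language.2 ⟨l, hl, rfl⟩⟩

end STerm

namespace Forest

theorem exists_compatible (f : Forest S) : ∃ w, Compatible f A_p w := by
  simp only [compatible_iff_mem_language]
  induction f with
  | nil => exact ⟨[], rfl⟩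
  | cons t f ih =>
    obtain ⟨w, hw⟩ := t.language_nonempty (P := ForestAlphabet.IsRoot A_p) (u := [])
      fun _ => ⟨0, rfl⟩
    obtain ⟨w', hw'⟩ := ih
    exact ⟨w ++ w', Language.append_mem_mul hw hw'⟩

theorem path_eq_nil_of_compatible_cons {f : Forest S} (hf : STerm.leaf ∉ f)
    {a : (A_p).carrier} {v : List (A_p).carrier} (hw : Compatible f A_p (a :: v)) :
    path a = [] := by
  rw [compatible_iff_mem_language] at hw
  cases f with
  | nil => exact absurd ((Language.mem_one _).1 hw) (List.cons_ne_nil _ _)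
  | cons t f =>
    obtain ⟨_, hv, v', -, heq⟩ := Language.mem_mul.1 hw
    obtain ⟨b, v, rfl, hb, -⟩ :=
      STerm.exists_cons_of_mem_language (List.ne_of_not_mem_cons hf).symm hv
    rwa [← (List.cons.inj heq).1]

/-- The letters with an empty path mark the beginnings of the terms of a forest. -/
theorem exists_cons_of_compatible {t : STerm S} {f : Forest S} (hf : STerm.leaf ∉ t :: f)
    {w : List (A_p).carrier} (hw : Compatible (t :: f) A_p w) :
    ∃ a v, w = a :: v ∧
      a :: v.takeWhile (path · ≠ []) ∈ t.language A_p (ForestAlphabet.IsRoot A_p) ∧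
      Compatible f A_p (v.dropWhile (path · ≠ [])) := by
  obtain ⟨_, hv, v', hv', rfl⟩ := Language.mem_mul.1 (compatible_iff_mem_language.1 hw)
  obtain ⟨a, v, rfl, -, hpath⟩ :=
    STerm.exists_cons_of_mem_language (List.ne_of_not_mem_cons hf).symm hv
  replace hv' := compatible_iff_mem_language.2 hv'
  have hpos : ∀ b ∈ v, decide (path b ≠ []) := by simpa using hpath
  refine ⟨a, v ++ v', rfl, ?_⟩
  rw [List.takeWhile_append_of_pos hpos, List.dropWhile_append_of_pos hpos]
  cases v' with
  | nil => exact ⟨by simpa using hv, hv'⟩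
  | cons b v' =>
    have hb := path_eq_nil_of_compatible_cons (List.not_mem_of_not_mem_cons hf) hv'
    simpa [List.takeWhile_cons, List.dropWhile_cons, hb] using ⟨hv, hv'⟩

theorem eq_of_compatible {f g : Forest S} (hf : STerm.leaf ∉ f) (hg : STerm.leaf ∉ g)
    {w : List (A_p).carrier} (hw : Compatible f A_p w) (hw' : Compatible g A_p w) : f = g := by
  induction f generalizing g w with
  | nil =>
    obtain rfl : w = [] := (Language.mem_one _).1 (compatible_iff_mem_language.1 hw)
    cases g with
    | nil => rfl
    | cons t' g =>
      obtain ⟨_, _, hnil, -⟩ := exists_cons_of_compatible hg hw'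
      exact absurd hnil.symm (List.cons_ne_nil _ _)
  | cons t f ih =>
    obtain ⟨a, v, rfl, ht, hf'⟩ := exists_cons_of_compatible hf hw
    cases g with
    | nil =>
      exact absurd ((Language.mem_one _).1 (compatible_iff_mem_language.1 hw'))
        (List.cons_ne_nil _ _)
    | cons t' g =>
      obtain ⟨_, _, heq, ht', hg'⟩ := exists_cons_of_compatible hg hw'
      obtain ⟨rfl, rfl⟩ := List.cons.inj heq
      rw [STerm.eq_of_mem_language ht ht', ih (List.not_mem_of_not_mem_cons hf)
        (List.not_mem_of_not_mem_cons hg) hf' hg']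

end Forest

theorem realize_positions_injective {K : Type v} [Field K] :
    Function.Injective (realize K A_p) := by
  choose m hm using fun w : (freeOperad S).RWord => Forest.exists_compatible w.word
  refine natAlg_injective_of_dual (M := Poly K (A_p).carrier)
    (fun w => LinearMap.proj (m w) ∘ₗ (polySubmodule K (A_p).carrier).subtype) (fun w => ?_)
    fun w w' hne => ?_
  all_goals refine (congrArg (fun F : Poly K _ => F.1 (m _)) (realize_elem K A_p _)).trans ?_
  · exact if_pos (hm w)
  · exact if_neg fun h => hne (Operad.word_injective (Forest.eq_of_compatible
      (Operad.unit_notMem_word w') (Operad.unit_notMem_word w) h (hm w)))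

end Positions

section QuotientRealize

open Operad.Congruence

variable {K : Type v} [Field K] {S : Signature.{u}} {c : (freeOperad S).Congruence}

theorem quotientMap_elem (hfin : c.FiniteType) (w : c.quotient.RWord) :
    quotientMap K c (elem K w) = ∑ f ∈ wordFiber (c := c) hfin w, elem K f := by
  refine (natLift_elem _ w).trans ((finsum_mem_congr (Set.ext fun f => ?_) fun _ _ => rfl).trans
    (finsum_mem_coe_finset (M := NatAlg K (freeOperad S)) _ (wordFiber (c := c) hfin w)))
  exact (mem_wordFiber (c := c) hfin).symm

theorem quotientMap_eq_fiberHom (hdeg : c.DegreeCompatible) (hfin : c.FiniteType) :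
    quotientMap K c = (fiberHom (c := c) K hfin).toLinearMap :=
  natAlg_linearMap_ext fun w =>
    (quotientMap_elem hfin w).trans (fiberHom_elem (c := c) K hfin (isGrading_degree S) hdeg w).symm

theorem quotientMap_injective (hdeg : c.DegreeCompatible) (hfin : c.FiniteType) :
    Function.Injective (quotientMap K c) := by
  rw [quotientMap_eq_fiberHom hdeg hfin]
  exact fiberHom_injective (c := c) K hfin (isGrading_degree S) hdeg

theorem quotientRealize_eq (hdeg : c.DegreeCompatible) (hfin : c.FiniteType)
    (A : ForestAlphabet S.carrier) :
    quotientRealize K c A = ((realizeHom K A).comp (fiberHom (c := c) K hfin)).toLinearMap := by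
  rw [quotientRealize, realize_eq_realizeHom, quotientMap_eq_fiberHom hdeg hfin]
  rfl

theorem quotientRealize_mem_polyGrading (hdeg : c.DegreeCompatible) (hfin : c.FiniteType)
    (A : ForestAlphabet S.carrier) {n : ℕ} {x : NatAlg K c.quotient}
    (hx : x ∈ natGrading K (c.quotDegree hdeg) n) :
    quotientRealize K c A x ∈ polyGrading K A.carrier n := by
  refine Submodule.span_le (p := (polyGrading K A.carrier n).comap (quotientRealize K c A)).2
    ?_ hx
  rintro _ ⟨w, hw, rfl⟩
  change realize K A (quotientMap K c (elem K w)) ∈ polyGrading K A.carrier n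
  rw [quotientMap_elem hfin, map_sum]
  refine Submodule.sum_mem _ fun f hf => ?_
  rw [realize_elem]
  refine fun m hm => if_neg fun h => hm ?_
  calc
    m.length = (f.word.map STerm.degree).sum := h.length
    _ = ((f.word.map c.proj).map (c.quotDegree hdeg)).sum :=
      congrArg List.sum (List.map_map (g := c.quotDegree hdeg) (f := c.proj)).symm
    _ = n := by rw [(mem_wordFiber (c := c) hfin).1 hf, hw]

theorem doubles_quotientRealize (hdeg : c.DegreeCompatible) (hfin : c.FiniteType)
    (A B : ForestAlphabet S.carrier) (x : NatAlg K c.quotient) :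
    Doubles (quotientRealize K c (sumAlphabet A B) x)
      (TensorProduct.map (quotientRealize K c A) (quotientRealize K c B)
        (comul K c.quotient x)) := by
  have h := doubles_realizeHom (A := A) (B := B) (fiberHom (c := c) K hfin x)
  rw [comul_fiberHom (c := c) K hfin (isGrading_degree S) hdeg
    (freeOperad_finitelyFactorizable S)] at h
  rw [quotientRealize_eq hdeg hfin, quotientRealize_eq hdeg hfin, quotientRealize_eq hdeg hfin]
  refine Eq.subst (motive := Doubles _) ?_ h
  exact DFunLike.congr_fun (Algebra.TensorProduct.map_comp _ _ _ _).symm (comul K c.quotient x)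

end QuotientRealize

theorem sumRel_assoc {S : Signature.{u}} (A B C : ForestAlphabet S.carrier)
    (r : ForestSymbol S.carrier)
    (x : Fin ((forestSignature S.carrier).arity r) → (A.carrier ⊕ B.carrier) ⊕ C.carrier) :
    (sumAlphabet (sumAlphabet A B) C).rel r x ↔
      (sumAlphabet A (sumAlphabet B C)).rel r (fun i => Equiv.sumAssoc _ _ _ (x i)) := by
  cases r with
  | root | dec s =>
    change Sum.elim _ _ (x 0) ↔ Sum.elim _ _ (Equiv.sumAssoc _ _ _ (x 0))
    obtain (a | b) | d := x 0 <;> exact Iff.rfl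
  | edge j =>
    simp only [ForestAlphabet.sumRel]
    generalize x 0 = y
    generalize x 1 = z
    obtain (a | b) | d := y <;> obtain (a' | b') | d' := z <;> exact Iff.rfl

end NatHopf

end

theorem mainTheorem3_general {K : Type v} [Field K] (S : Signature.{u})
    (c : (freeOperad S).Congruence) (hdeg : c.DegreeCompatible) (hfin : c.FiniteType) :
    c.quotient.FinitelyFactorizable ∧
    c.quotient.IsGrading (c.quotDegree hdeg) ∧
    IsHopfAlgebra (comul K c.quotient) (counit K c.quotient) ∧
    IsPolynomialRealization (natGrading K (c.quotDegree hdeg)) (comul K c.quotient)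
      (Set.univ : Set (ForestAlphabet S.carrier)) (ForestAlphabet.sumRel S.carrier)
      (fun A => quotientRealize K c A) (ForestAlphabet.positions S.carrier) := by
  have hfact := Operad.Congruence.finitelyFactorizable_quotient (c := c) hfin
    (freeOperad_finitelyFactorizable S)
  have hgrad : c.quotient.IsGrading (c.quotDegree hdeg) :=
    Operad.Congruence.isGrading_quotient c (isGrading_degree S) hdeg
  refine ⟨hfact, hgrad, isHopfAlgebra_natAlg K hfact hgrad, ?_⟩
  have hhom := fun A => quotientRealize_eq (K := K) hdeg hfin A
  exact
    { positive := fun r => by cases r <;> simp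
      sum_mem := fun _ _ _ _ => trivial
      sum_assoc := fun A _ B _ C _ => sumRel_assoc A B C
      map_one := fun A _ => by rw [hhom]; exact map_one ((realizeHom K A).comp _)
      map_mul := fun A _ x y => by rw [hhom]; exact map_mul ((realizeHom K A).comp _) x y
      graded := fun A _ _ _ hx => quotientRealize_mem_polyGrading hdeg hfin A hx
      doubling := fun A _ B _ x => doubles_quotientRealize hdeg hfin A B x
      mem := trivial
      injective := realize_positions_injective.comp (quotientMap_injective hdeg hfin) }

theorem mainTheorem3 {K : Type v} [Field K] [CharZero K] (S : Signature.{u})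
    (c : (freeOperad S).Congruence) (hdeg : c.DegreeCompatible) (hfin : c.FiniteType) :
    c.quotient.FinitelyFactorizable ∧
    c.quotient.IsGrading (c.quotDegree hdeg) ∧
    IsHopfAlgebra (comul K c.quotient) (counit K c.quotient) ∧
    IsPolynomialRealization (natGrading K (c.quotDegree hdeg)) (comul K c.quotient)
      (Set.univ : Set (ForestAlphabet S.carrier)) (ForestAlphabet.sumRel S.carrier)
      (fun A => quotientRealize K c A) (ForestAlphabet.positions S.carrier) :=
  mainTheorem3_general S c hdeg hfin
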